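/- Let $\mathbb D$ be the open unit disk in $\mathbb C$ and $H(\mathbb D)$ the set of analytic functions on $\mathbb D$. Let $H^\infty$ be the Banach space of bounded $f\in H(\mathbb D)$ with the supremum norm, and let the Bloch space $\mathcal B$ be the set of $f\in H(\mathbb D)$ with $\|f\|_{\mathcal B}:=\sup_{z\in\mathbb D}(1-|z|^2)|f'(z)|<\infty$, a Banach space under the norm $|f(0)|+\|f\|_{\mathcal B}$. For $a\in\mathbb D$ put $\sigma_a(z)=\frac{a-z}{1-\bar a z}$. Let $u,v\in H(\mathbb D)$ and let $\varphi,\psi$ be analytic self-maps of $\mathbb D$. Write $\rho(z)=\left|\frac{\varphi(z)-\psi(z)}{1-\overline{\psi(z)}\varphi(z)}\right|$ and $(uC_\varphi f)(z)=u(z)f(\varphi(z))$, $(vC_\psi f)(z)=v(z)f(\psi(z))$. Assume (A) $\sup_{z\in\mathbb D}(1-|z|^2)|u'(z)|\rho(z)<\infty$ and $\sup_{z\in\mathbb D}(1-|z|^2)|v'(z)|\rho(z)<\infty$; (B) $(1-|z|^2)|u'(z)|\rho(z)\to0$ and $(1-|z|^2)|v'(z)|\rho(z)\to0$ as $\rho(z)\to0$;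 that is, for every $\varepsilon>0$ there is $\delta>0$ such that both quantities are less than $\varepsilon$ at every $z\in\mathbb D$ with $\rho(z)<\delta$. Suppose that $uC_\varphi-vC_\psi$ is a bounded operator from $H^\infty$ to $\mathcal B$. Then the following are equivalent: (i) $uC_\varphi-vC_\psi:H^\infty\to\mathcal B$ is compact; (ii) for every $(n,m)\in\{(0,0),(0,1),(0,2),(1,2)\}$, $$\lim_{|a|\to1}\ \sup_{b\in\mathbb D}\left\|(uC_\varphi-vC_\psi)\big((\sigma_a^{n+1}-a\sigma_a^{n})\sigma_b^{m}\big)\right\|_{\mathcal B}=0;$$ (iii) $\displaystyle\lim_{k\to\infty}\|u\varphi^k-v\psi^k\|_{\mathcal B}=0.$ -/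

import Mathlib

open Filter Topology
open scoped ENNReal ComplexConjugate BoundedContinuousFunction Complex.UnitDisc

noncomputable section

namespace BlochDiff

/-- The extension by zero to `ℂ` of a function on the open unit disc. Inside the disc it has the
same values and the same derivatives as the given function. -/
def ext (f : 𝔻 → ℂ) : ℂ → ℂ := Function.extend Complex.UnitDisc.coe f 0

/-- `f` is analytic in the open unit disc, i.e. `f ∈ H(𝔻)`. -/
def Holo (f : 𝔻 → ℂ) : Prop := DifferentiableOn ℂ (ext f) (Metric.ball 0 1)

/-- The complex derivative `f'(z)` of a function on the disc. -/
def dderiv (f : 𝔻 → ℂ) (z : 𝔻) : ℂ := deriv (ext f) (z : ℂ)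

theorem ext_coe (f : 𝔻 → ℂ) (z : 𝔻) : ext f (z : ℂ) = f z :=
  Complex.UnitDisc.coe_injective.extend_apply f 0 z

theorem ext_outside (f : 𝔻 → ℂ) {w : ℂ} (hw : ¬ ‖w‖ < 1) : ext f w = 0 := by
  unfold ext
  rw [Function.extend_apply']
  · rfl
  · rintro ⟨z, rfl⟩
    exact hw z.norm_lt_one

theorem ext_add (f g : 𝔻 → ℂ) : ext (f + g) = ext f + ext g := by
  funext w
  by_cases hw : ‖w‖ < 1
  · lift w to 𝔻 using hw
    simp [ext_coe]
  · simp [ext_outside _ hw]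

theorem ext_smul (c : ℂ) (f : 𝔻 → ℂ) : ext (c • f) = c • ext f := by
  funext w
  by_cases hw : ‖w‖ < 1
  · lift w to 𝔻 using hw
    simp [ext_coe]
  · simp [ext_outside _ hw]

theorem ext_zero : ext 0 = 0 := by
  simpa using ext_smul 0 0

theorem Holo.differentiableAt {f : 𝔻 → ℂ} (hf : Holo f) (z : 𝔻) :
    DifferentiableAt ℂ (ext f) (z : ℂ) :=
  DifferentiableOn.differentiableAt hf
    (Metric.isOpen_ball.mem_nhds (mem_ball_zero_iff.2 z.norm_lt_one))

theorem Holo.add {f g : 𝔻 → ℂ} (hf : Holo f) (hg : Holo g) : Holo (f + g) := by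
  unfold Holo
  rw [ext_add]
  exact DifferentiableOn.add hf hg

theorem Holo.smul (c : ℂ) {f : 𝔻 → ℂ} (hf : Holo f) : Holo (c • f) := by
  unfold Holo
  rw [ext_smul]
  exact DifferentiableOn.const_smul hf c

theorem Holo.zero : Holo 0 := by
  unfold Holo
  rw [ext_zero]
  exact differentiableOn_const 0

theorem dderiv_add {f g : 𝔻 → ℂ} (hf : Holo f) (hg : Holo g) (z : 𝔻) :
    dderiv (f + g) z = dderiv f z + dderiv g z := by
  unfold dderiv
  rw [ext_add]
  exact deriv_add (hf.differentiableAt z) (hg.differentiableAt z)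

theorem dderiv_smul (c : ℂ) {f : 𝔻 → ℂ} (hf : Holo f) (z : 𝔻) :
    dderiv (c • f) z = c * dderiv f z := by
  unfold dderiv
  rw [ext_smul]
  exact deriv_const_smul c (hf.differentiableAt z)

/-- The space `H^∞` of bounded analytic functions on the disc. Its norm, inherited from the
bounded continuous functions, is the supremum norm. -/
def HInf : Submodule ℂ (𝔻 →ᵇ ℂ) where
  carrier := {f | Holo f}
  add_mem' hf hg := Holo.add hf hg
  zero_mem' := Holo.zero
  smul_mem' c _ hf := Holo.smul c hf

/-- The Bloch seminorm `‖f‖_𝓑 = sup_z (1 - |z|²) |f'(z)|`, with value in `[0, ∞]`. -/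
def blochSemi (f : 𝔻 → ℂ) : ℝ≥0∞ :=
  ⨆ z : 𝔻, ENNReal.ofReal ((1 - ‖(z : ℂ)‖ ^ 2) * ‖dderiv f z‖)

theorem blochSemi_add_le {f g : 𝔻 → ℂ} (hf : Holo f) (hg : Holo g) :
    blochSemi (f + g) ≤ blochSemi f + blochSemi g := by
  refine iSup_le fun z => ?_
  have hz : 0 ≤ 1 - ‖(z : ℂ)‖ ^ 2 := (sub_pos.2 z.sq_norm_lt_one).le
  refine le_trans ?_ (add_le_add (le_iSup _ z) (le_iSup _ z))
  rw [← ENNReal.ofReal_add (by positivity) (by positivity), dderiv_add hf hg, ← mul_add]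
  exact ENNReal.ofReal_le_ofReal (mul_le_mul_of_nonneg_left (norm_add_le _ _) hz)

theorem blochSemi_smul (c : ℂ) {f : 𝔻 → ℂ} (hf : Holo f) :
    blochSemi (c • f) = ENNReal.ofReal ‖c‖ * blochSemi f := by
  unfold blochSemi
  rw [ENNReal.mul_iSup]
  refine iSup_congr fun z => ?_
  rw [dderiv_smul c hf, norm_mul, ← ENNReal.ofReal_mul (norm_nonneg _)]
  congr 1
  ring

theorem blochSemi_zero : blochSemi 0 = 0 := by
  simpa using blochSemi_smul 0 Holo.zero

/-- The underlying vector space of the Bloch space. -/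
def blochSubmodule : Submodule ℂ (𝔻 → ℂ) where
  carrier := {f | Holo f ∧ blochSemi f < ∞}
  add_mem' hf hg := ⟨hf.1.add hg.1,
    (blochSemi_add_le hf.1 hg.1).trans_lt (ENNReal.add_lt_top.2 ⟨hf.2, hg.2⟩)⟩
  zero_mem' := ⟨Holo.zero, by rw [blochSemi_zero]; exact ENNReal.zero_lt_top⟩
  smul_mem' c f hf := ⟨hf.1.smul c, by
    rw [blochSemi_smul c hf.1]
    exact ENNReal.mul_lt_top ENNReal.ofReal_lt_top hf.2⟩

/-- The Bloch space `𝓑`. It is a separate type, so that its topology is the one of the Bloch norm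
and not the one of pointwise convergence. -/
def Bloch : Type := ↥blochSubmodule

namespace Bloch

instance : AddCommGroup Bloch := inferInstanceAs (AddCommGroup ↥blochSubmodule)

instance : Module ℂ Bloch := inferInstanceAs (Module ℂ ↥blochSubmodule)

/-- The function on the disc underlying an element of the Bloch space. -/
def toFun (f : Bloch) : 𝔻 → ℂ := Subtype.val f

theorem holo (f : Bloch) : Holo f.toFun := (Subtype.property f).1

theorem semi_lt_top (f : Bloch) : blochSemi f.toFun < ∞ := (Subtype.property f).2

/-- The Bloch norm `|f(0)| + ‖f‖_𝓑`. -/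
instance : Norm Bloch := ⟨fun f => ‖f.toFun 0‖ + (blochSemi f.toFun).toReal⟩

theorem norm_def (f : Bloch) : ‖f‖ = ‖f.toFun 0‖ + (blochSemi f.toFun).toReal := rfl

theorem toFun_add (f g : Bloch) : (f + g).toFun = f.toFun + g.toFun := rfl

theorem toFun_smul (c : ℂ) (f : Bloch) : (c • f).toFun = c • f.toFun := rfl

theorem eq_zero_of_norm (f : Bloch) (h : ‖f‖ = 0) : f = 0 := by
  rw [norm_def] at h
  obtain ⟨h0, h1⟩ := (add_eq_zero_iff_of_nonneg (norm_nonneg _) ENNReal.toReal_nonneg).1 h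
  have h2 : blochSemi f.toFun = 0 :=
    ((ENNReal.toReal_eq_zero_iff _).1 h1).resolve_right f.semi_lt_top.ne
  have hd : ∀ w ∈ Metric.ball (0 : ℂ) 1, deriv (ext f.toFun) w = 0 := by
    intro w hw
    rw [mem_ball_zero_iff] at hw
    lift w to 𝔻 using hw
    have h3 := ENNReal.iSup_eq_zero.1 h2 w
    rw [ENNReal.ofReal_eq_zero] at h3
    have h4 : 0 < 1 - ‖(w : ℂ)‖ ^ 2 := sub_pos.2 w.sq_norm_lt_one
    have h5 : ‖dderiv f.toFun w‖ ≤ 0 := by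
      by_contra! h6
      exact absurd (mul_pos h4 h6) (not_lt.2 h3)
    exact norm_le_zero_iff.1 h5
  apply Subtype.ext
  funext z
  have h7 := Metric.isOpen_ball.is_const_of_deriv_eq_zero
    (convex_ball (0 : ℂ) 1).isPreconnected f.holo hd
    (mem_ball_zero_iff.2 z.norm_lt_one) (Metric.mem_ball_self one_pos)
  have h8 : ext f.toFun 0 = f.toFun 0 := ext_coe f.toFun 0
  rw [ext_coe, h8, norm_eq_zero.1 h0] at h7
  exact h7

theorem core : NormedSpace.Core ℂ Bloch where
  norm_nonneg f := add_nonneg (norm_nonneg _) ENNReal.toReal_nonneg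
  norm_smul c f := by
    rw [norm_def, norm_def, toFun_smul, blochSemi_smul c f.holo, ENNReal.toReal_mul,
      ENNReal.toReal_ofReal (norm_nonneg c), Pi.smul_apply, norm_smul, mul_add]
  norm_triangle f g := by
    rw [norm_def, norm_def, norm_def, toFun_add, Pi.add_apply]
    have h1 := norm_add_le (f.toFun 0) (g.toFun 0)
    have h2 := ENNReal.toReal_mono
      (ENNReal.add_lt_top.2 ⟨f.semi_lt_top, g.semi_lt_top⟩).ne (blochSemi_add_le f.holo g.holo)
    rw [ENNReal.toReal_add f.semi_lt_top.ne g.semi_lt_top.ne] at h2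
    linarith
  norm_eq_zero_iff f := by
    refine ⟨eq_zero_of_norm f, ?_⟩
    rintro rfl
    have h : (0 : Bloch).toFun = 0 := rfl
    rw [norm_def, h, blochSemi_zero]
    simp

instance : NormedAddCommGroup Bloch := NormedAddCommGroup.ofCore core

instance : NormedSpace ℂ Bloch := NormedSpace.ofCore core

end Bloch

/-- The weighted composition operator `(u C_φ f)(z) = u(z) f(φ(z))`. -/
def wComp (u : 𝔻 → ℂ) (φ : 𝔻 → 𝔻) : (𝔻 → ℂ) →ₗ[ℂ] (𝔻 → ℂ) where
  toFun f := fun z => u z * f (φ z)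
  map_add' f g := by
    funext z
    simp [mul_add]
  map_smul' c f := by
    funext z
    simp [mul_left_comm]

/-- `S` restricts to the continuous linear operator `T : H^∞ → 𝓑`. -/
def Restricts (S : (𝔻 → ℂ) →ₗ[ℂ] (𝔻 → ℂ)) (T : HInf →L[ℂ] Bloch) : Prop :=
  ∀ f : HInf, (T f).toFun = S (f : 𝔻 →ᵇ ℂ)

/-- `S : H^∞ → 𝓑` is bounded. -/
def IsBoundedOp (S : (𝔻 → ℂ) →ₗ[ℂ] (𝔻 → ℂ)) : Prop :=
  ∃ T : HInf →L[ℂ] Bloch, Restricts S T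

/-- `S : H^∞ → 𝓑` is compact. -/
def IsCompactOp (S : (𝔻 → ℂ) →ₗ[ℂ] (𝔻 → ℂ)) : Prop :=
  ∃ T : HInf →L[ℂ] Bloch, Restricts S T ∧ IsCompactOperator T

/-- The disc automorphism `σ_a(z) = (a - z) / (1 - ā z)`, as a complex-valued function. -/
def σ (a : 𝔻) : 𝔻 → ℂ := fun z => ((a : ℂ) - z) / (1 - conj (a : ℂ) * z)

/-- The pseudo-hyperbolic distance `ρ(z, w) = |σ_w(z)|`. -/
def pseudoDist (z w : 𝔻) : ℝ := ‖σ w z‖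

/-- `(1 - |z|²) |u'(z)| ρ(φ(z), ψ(z))`. -/
def weight (φ ψ : 𝔻 → 𝔻) (u : 𝔻 → ℂ) (z : 𝔻) : ℝ :=
  (1 - ‖(z : ℂ)‖ ^ 2) * ‖dderiv u z‖ * pseudoDist (φ z) (ψ z)

/-- `(1 - |z|²) |u'(z)| ρ(φ(z), ψ(z))` and its analogue for `v` are bounded on the disc. -/
def CondA (u v : 𝔻 → ℂ) (φ ψ : 𝔻 → 𝔻) : Prop :=
  BddAbove (Set.range (weight φ ψ u)) ∧ BddAbove (Set.range (weight φ ψ v))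

/-- The filter on the disc that describes `ρ(φ(z), ψ(z)) → 0`. -/
def rhoToZero (φ ψ : 𝔻 → 𝔻) : Filter 𝔻 :=
  comap (fun z => pseudoDist (φ z) (ψ z)) (𝓝 0)

/-- `(1 - |z|²) |u'(z)| ρ(φ(z), ψ(z))` and its analogue for `v` tend to `0` as
`ρ(φ(z), ψ(z)) → 0`. -/
def CondB (u v : 𝔻 → ℂ) (φ ψ : 𝔻 → 𝔻) : Prop :=
  Tendsto (weight φ ψ u) (rhoToZero φ ψ) (𝓝 0) ∧ Tendsto (weight φ ψ v) (rhoToZero φ ψ) (𝓝 0)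

/-- The filter on the disc that describes `|a| → 1`. -/
def toBoundary : Filter 𝔻 := comap (fun a : 𝔻 => ‖(a : ℂ)‖) (𝓝 1)

/-- The test function `(σ_a^{n+1} - a σ_a^n) σ_b^m`. -/
def testFun (n m : ℕ) (a b : 𝔻) : 𝔻 → ℂ :=
  (σ a ^ (n + 1) - (a : ℂ) • σ a ^ n) * σ b ^ m

end BlochDiff

end

open BlochDiff

/-! Fix `z`, put `p = φ z`, `q = ψ z`, `ρ = pseudoDist p q`, and write `∂f(w) = (1 - |w|²) f'(w)`.
Then `(1 - |z|²)(u C_φ f - v C_ψ f)'(z) = A f(p) + C ∂f(p) - B f(q) - D ∂f(q)`, so everything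
reduces to four coefficients and two 1-jets.

(ii) → (i). With `a = p`, `b = q` the factor `σ_q²` kills the jet at `q`. The tests (0,2), (1,2) and
condition (B) then make `Aρ` and `Cρ` small as `p` nears the boundary (`small_of_tests`), and
likewise `Bρ`, `Dρ` at `q`. With `a = b = p` the tests (0,0), (0,1) make `A - B` and `C + D ∂σ_p(q)`
small (`norm_diff_le_of_tests`). These combinations suffice because `f(p) - f(q)` and `∂σ_p(q) ∂f(p)
+ ∂f(q)` are `O(ρ)` by Cauchy estimates (`LocBdd.estimates`, `norm_jetDiff_le`). Hence bounded
functions that are small on a large compact set have small images (`exists_compact_small`), and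
Montel's theorem gives compactness.

(i) → (iii). The monomials are bounded and their images tend to zero pointwise, so a compact
operator sends them to zero in norm.

(iii) → (ii). The Taylor coefficients of a test function have bounded absolute sum and are each `O(1
- |a|²)`, uniformly in `b`. Early monomials are controlled by the small coefficients, late ones by
(iii) (`norm_map_le_of_hasAbsSeries`). -/

noncomputable section

namespace BlochDiff

/-! ### Functions on the disc and their derivatives -/

theorem ball_mem_nhds (z : 𝔻) : Metric.ball (0 : ℂ) 1 ∈ 𝓝 (z : ℂ) :=
  Metric.isOpen_ball.mem_nhds (mem_ball_zero_iff.2 z.norm_lt_one)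

/-- A function on the disc that agrees with `g : ℂ → ℂ` inherits the derivatives of `g`. -/
theorem hasDerivAt_ext {f : 𝔻 → ℂ} {g : ℂ → ℂ} (h : ∀ w : 𝔻, f w = g w) {z : 𝔻} {g' : ℂ}
    (hg : HasDerivAt g g' z) : HasDerivAt (ext f) g' z := by
  refine hg.congr_of_eventuallyEq ?_
  filter_upwards [ball_mem_nhds z] with w hw
  rw [mem_ball_zero_iff] at hw
  lift w to 𝔻 using hw
  rw [ext_coe, h]

theorem holo_of_hasDerivAt {f : 𝔻 → ℂ} {f' : 𝔻 → ℂ}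
    (h : ∀ z : 𝔻, HasDerivAt (ext f) (f' z) z) : Holo f := by
  intro w hw
  rw [mem_ball_zero_iff] at hw
  lift w to 𝔻 using hw
  exact (h w).differentiableAt.differentiableWithinAt

theorem Holo.hasDerivAt {f : 𝔻 → ℂ} (hf : Holo f) (z : 𝔻) :
    HasDerivAt (ext f) (dderiv f z) z :=
  (hf.differentiableAt z).hasDerivAt

theorem Holo.continuous {f : 𝔻 → ℂ} (hf : Holo f) : Continuous f := by
  have h : f = fun z : 𝔻 => ext f z := by
    funext z
    rw [ext_coe]
  rw [h]
  exact ContinuousOn.comp_continuous (DifferentiableOn.continuousOn hf)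
    Complex.UnitDisc.continuous_coe fun z => mem_ball_zero_iff.2 z.norm_lt_one

theorem hasDerivAt_ext_mul {f g : 𝔻 → ℂ} (hf : Holo f) (hg : Holo g) (z : 𝔻) :
    HasDerivAt (ext (f * g)) (dderiv f z * g z + f z * dderiv g z) z := by
  have h := hasDerivAt_ext (f := f * g) (fun w => by simp [ext_coe])
    ((hf.hasDerivAt z).mul (hg.hasDerivAt z))
  simpa only [ext_coe] using h

theorem Holo.mul {f g : 𝔻 → ℂ} (hf : Holo f) (hg : Holo g) : Holo (f * g) :=
  holo_of_hasDerivAt (hasDerivAt_ext_mul hf hg)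

theorem Holo.sub {f g : 𝔻 → ℂ} (hf : Holo f) (hg : Holo g) : Holo (f - g) := by
  rw [sub_eq_add_neg, ← neg_one_smul ℂ g]
  exact hf.add (hg.smul _)

theorem dderiv_sub {f g : 𝔻 → ℂ} (hf : Holo f) (hg : Holo g) (z : 𝔻) :
    dderiv (f - g) z = dderiv f z - dderiv g z := by
  rw [sub_eq_add_neg, ← neg_one_smul ℂ g, dderiv_add hf (hg.smul _), dderiv_smul _ hg]
  ring

theorem hasDerivAt_ext_one (z : 𝔻) : HasDerivAt (ext 1) 0 z :=
  hasDerivAt_ext (g := fun _ => 1) (fun _ => rfl) (hasDerivAt_const _ _)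

theorem Holo.one : Holo 1 := holo_of_hasDerivAt hasDerivAt_ext_one

theorem Holo.pow {f : 𝔻 → ℂ} (hf : Holo f) (n : ℕ) : Holo (f ^ n) := by
  induction n with
  | zero => simpa using Holo.one
  | succ n ih => simpa [pow_succ] using ih.mul hf

theorem Holo.coe : Holo (fun z : 𝔻 => (z : ℂ)) :=
  holo_of_hasDerivAt fun z => hasDerivAt_ext (g := id) (fun _ => rfl) (hasDerivAt_id (z : ℂ))

theorem hasDerivAt_ext_wComp {u f : 𝔻 → ℂ} {φ : 𝔻 → 𝔻} (hu : Holo u)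
    (hφ : Holo (fun z => (φ z : ℂ))) (hf : Holo f) (z : 𝔻) :
    HasDerivAt (ext (wComp u φ f)) (dderiv u z * f (φ z) +
      u z * (dderiv f (φ z) * dderiv (fun z => (φ z : ℂ)) z)) z := by
  have h1 : HasDerivAt (ext f) (dderiv f (φ z)) (ext (fun z => (φ z : ℂ)) z) := by
    rw [ext_coe]
    exact hf.hasDerivAt (φ z)
  have h := hasDerivAt_ext (f := wComp u φ f) (fun w => by simp [ext_coe, wComp])
    ((hu.hasDerivAt z).mul (h1.comp (z : ℂ) (hφ.hasDerivAt z)))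
  simpa only [ext_coe, Function.comp] using h

theorem Holo.wComp {u f : 𝔻 → ℂ} {φ : 𝔻 → 𝔻} (hu : Holo u)
    (hφ : Holo (fun z => (φ z : ℂ))) (hf : Holo f) : Holo (wComp u φ f) :=
  holo_of_hasDerivAt (hasDerivAt_ext_wComp hu hφ hf)

/-- A bounded analytic function as an element of `H^∞`. -/
def mkHInf (f : 𝔻 → ℂ) (hf : Holo f) (M : ℝ) (hM : ∀ z, ‖f z‖ ≤ M) : HInf :=
  ⟨BoundedContinuousFunction.ofNormedAddCommGroup f hf.continuous M hM, hf⟩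

theorem coe_mkHInf (f : 𝔻 → ℂ) (hf : Holo f) (M : ℝ) (hM : ∀ z, ‖f z‖ ≤ M) :
    ((mkHInf f hf M hM : 𝔻 →ᵇ ℂ) : 𝔻 → ℂ) = f := rfl

theorem norm_mkHInf_le (f : 𝔻 → ℂ) (hf : Holo f) {M : ℝ} (hM : ∀ z, ‖f z‖ ≤ M) :
    ‖mkHInf f hf M hM‖ ≤ M :=
  (BoundedContinuousFunction.norm_le ((norm_nonneg _).trans (hM 0))).2 hM

theorem HInf.norm_apply_le (f : HInf) (z : 𝔻) : ‖(f : 𝔻 →ᵇ ℂ) z‖ ≤ ‖f‖ :=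
  BoundedContinuousFunction.norm_coe_le_norm (f : 𝔻 →ᵇ ℂ) z

/-! ### Disc automorphisms -/

/-- The Möbius map `w ↦ (a - w) / (1 - ā w)` on the complex plane. -/
def mob (a w : ℂ) : ℂ := (a - w) / (1 - conj a * w)

theorem σ_eq_mob (a z : 𝔻) : σ a z = mob a z := rfl

theorem one_sub_conj_mul_ne_zero {a w : ℂ} (ha : ‖a‖ < 1) (hw : ‖w‖ < 1) :
    1 - conj a * w ≠ 0 := by
  intro h
  have h1 : ‖conj a * w‖ = 1 := by rw [← sub_eq_zero.1 h, norm_one]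
  rw [norm_mul, Complex.norm_conj] at h1
  nlinarith [norm_nonneg a, norm_nonneg w]

theorem norm_one_sub_conj_mul_sq_sub (a w : ℂ) :
    ‖1 - conj a * w‖ ^ 2 - ‖a - w‖ ^ 2 = (1 - ‖a‖ ^ 2) * (1 - ‖w‖ ^ 2) := by
  simp only [Complex.sq_norm, Complex.normSq_apply, Complex.sub_re, Complex.sub_im,
    Complex.mul_re, Complex.mul_im, Complex.conj_re, Complex.conj_im, Complex.one_re,
    Complex.one_im]
  ring

theorem one_sub_norm_mob_sq {a w : ℂ} (ha : ‖a‖ < 1) (hw : ‖w‖ < 1) :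
    1 - ‖mob a w‖ ^ 2 = (1 - ‖a‖ ^ 2) * (1 - ‖w‖ ^ 2) / ‖1 - conj a * w‖ ^ 2 := by
  have h : ‖1 - conj a * w‖ ≠ 0 := norm_ne_zero_iff.2 (one_sub_conj_mul_ne_zero ha hw)
  rw [← norm_one_sub_conj_mul_sq_sub, mob, norm_div, sub_div,
    div_self (pow_ne_zero 2 h), div_pow]

theorem norm_mob_lt_one {a w : ℂ} (ha : ‖a‖ < 1) (hw : ‖w‖ < 1) : ‖mob a w‖ < 1 := by
  have h : 0 < ‖1 - conj a * w‖ := norm_pos_iff.2 (one_sub_conj_mul_ne_zero ha hw)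
  have h1 := one_sub_norm_mob_sq ha hw
  have h2 : 0 < (1 - ‖a‖ ^ 2) * (1 - ‖w‖ ^ 2) / ‖1 - conj a * w‖ ^ 2 := by
    have : 0 < 1 - ‖a‖ ^ 2 := by nlinarith [norm_nonneg a]
    have : 0 < 1 - ‖w‖ ^ 2 := by nlinarith [norm_nonneg w]
    positivity
  nlinarith [norm_nonneg (mob a w)]

theorem mob_self (a : ℂ) : mob a a = 0 := by simp [mob]

theorem mob_mob {a w : ℂ} (ha : ‖a‖ < 1) (hw : ‖w‖ < 1) : mob a (mob a w) = w := by
  have h := one_sub_conj_mul_ne_zero ha hw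
  have h1 : 1 - conj a * a ≠ 0 := one_sub_conj_mul_ne_zero ha ha
  have h2 : 1 - conj a * ((a - w) / (1 - conj a * w)) = (1 - conj a * a) / (1 - conj a * w) := by
    field_simp
    ring
  unfold mob
  rw [h2, div_div_eq_mul_div, div_eq_iff h1, sub_mul, div_mul_cancel₀ _ h]
  ring

theorem norm_mob_comm (a w : ℂ) : ‖mob a w‖ = ‖mob w a‖ := by
  unfold mob
  rw [norm_div, norm_div, norm_sub_rev a w, ← Complex.norm_conj (1 - conj a * w)]
  simp [mul_comm]

theorem hasDerivAt_mob {a w : ℂ} (ha : ‖a‖ < 1) (hw : ‖w‖ < 1) :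
    HasDerivAt (mob a) (-((1 - ‖a‖ ^ 2 : ℝ) : ℂ) / (1 - conj a * w) ^ 2) w := by
  have h := one_sub_conj_mul_ne_zero ha hw
  have h1 : HasDerivAt (fun w => a - w) (-1) w := (hasDerivAt_id w).const_sub a
  have h2 : HasDerivAt (fun w => 1 - conj a * w) (-(conj a)) w := by
    simpa using ((hasDerivAt_id w).const_mul (conj a)).const_sub 1
  have h3 := h1.div h2 h
  have h4 : ((1 - ‖a‖ ^ 2 : ℝ) : ℂ) = 1 - conj a * a := by
    rw [Complex.conj_mul']
    push_cast
    ring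
  refine h3.congr_deriv ?_
  rw [h4]
  congr 1
  ring

theorem Holo.σ (a : 𝔻) : Holo (σ a) :=
  holo_of_hasDerivAt fun z => hasDerivAt_ext (g := mob a) (fun _ => rfl)
    (hasDerivAt_mob a.norm_lt_one z.norm_lt_one)

theorem norm_σ_le_one (a z : 𝔻) : ‖σ a z‖ ≤ 1 :=
  (norm_mob_lt_one a.norm_lt_one z.norm_lt_one).le

theorem σ_self (a : 𝔻) : σ a a = 0 := mob_self a

/-- `1 - |z|²`. -/
def defect (z : 𝔻) : ℝ := 1 - ‖(z : ℂ)‖ ^ 2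

theorem defect_pos (z : 𝔻) : 0 < defect z := sub_pos.2 z.sq_norm_lt_one

theorem defect_le_one (z : 𝔻) : defect z ≤ 1 := sub_le_self _ (sq_nonneg _)

/-- The invariant derivative `(1 - |w|²) f'(w)`. -/
def invDeriv (f : 𝔻 → ℂ) (w : 𝔻) : ℂ := (defect w : ℂ) * dderiv f w

theorem invDeriv_mul {f g : 𝔻 → ℂ} (hf : Holo f) (hg : Holo g) (z : 𝔻) :
    invDeriv (f * g) z = invDeriv f z * g z + f z * invDeriv g z := by
  unfold invDeriv
  rw [show dderiv (f * g) z = _ from (hasDerivAt_ext_mul hf hg z).deriv]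
  ring

theorem invDeriv_sub {f g : 𝔻 → ℂ} (hf : Holo f) (hg : Holo g) (z : 𝔻) :
    invDeriv (f - g) z = invDeriv f z - invDeriv g z := by
  unfold invDeriv
  rw [dderiv_sub hf hg]
  ring

theorem invDeriv_smul (c : ℂ) {f : 𝔻 → ℂ} (hf : Holo f) (z : 𝔻) :
    invDeriv (c • f) z = c * invDeriv f z := by
  unfold invDeriv
  rw [dderiv_smul c hf]
  ring

theorem invDeriv_one (z : 𝔻) : invDeriv 1 z = 0 := by
  unfold invDeriv
  rw [show dderiv 1 z = _ from (hasDerivAt_ext_one z).deriv, mul_zero]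

theorem invDeriv_σ (a w : 𝔻) : invDeriv (σ a) w =
    -((defect a : ℂ) * defect w) / (1 - conj (a : ℂ) * w) ^ 2 := by
  unfold invDeriv
  rw [show dderiv (σ a) w = _ from (hasDerivAt_ext (f := σ a) (fun _ => rfl)
    (hasDerivAt_mob a.norm_lt_one w.norm_lt_one)).deriv]
  unfold defect
  ring

theorem invDeriv_σ_self (a : 𝔻) : invDeriv (σ a) a = -1 := by
  have h1 : (1 - conj (a : ℂ) * a) = defect a := by
    rw [Complex.conj_mul', defect]
    push_cast
    ring
  have h2 : (defect a : ℂ) ≠ 0 := Complex.ofReal_ne_zero.2 (defect_pos a).ne'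
  rw [invDeriv_σ, h1]
  field_simp

theorem norm_invDeriv_σ (a w : 𝔻) : ‖invDeriv (σ a) w‖ = 1 - ‖σ a w‖ ^ 2 := by
  rw [invDeriv_σ, σ_eq_mob, one_sub_norm_mob_sq a.norm_lt_one w.norm_lt_one, norm_div, norm_neg,
    norm_mul, norm_pow, Complex.norm_of_nonneg (defect_pos a).le,
    Complex.norm_of_nonneg (defect_pos w).le]
  rfl

theorem pseudoDist_nonneg (z w : 𝔻) : 0 ≤ pseudoDist z w := norm_nonneg _

theorem pseudoDist_lt_one (z w : 𝔻) : pseudoDist z w < 1 :=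
  norm_mob_lt_one w.norm_lt_one z.norm_lt_one

theorem pseudoDist_comm (z w : 𝔻) : pseudoDist z w = pseudoDist w z := norm_mob_comm _ _

/-- A pseudo-hyperbolic neighbourhood of a compact part of the disc stays in a compact part. -/
theorem defect_le_of_pseudoDist {p q : 𝔻} (h : pseudoDist p q < 3 / 4) :
    7 / 64 * defect q ^ 2 ≤ defect p := by
  have h1 := one_sub_norm_mob_sq q.norm_lt_one p.norm_lt_one
  -- `7/16 = 1 - (3/4)²`; the bound `|1 - q̄p| ≥ 1 - |q| ≥ defect q / 2` below contributes the
  -- remaining factor `1/4` of `7/64`.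
  have h2 : 7 / 16 ≤ 1 - ‖mob q p‖ ^ 2 := by
    have h3 : ‖mob q p‖ < 3 / 4 := h
    nlinarith [norm_nonneg (mob q p)]
  have h4 : defect q / 2 ≤ ‖1 - conj (q : ℂ) * p‖ := by
    have h5 := norm_sub_norm_le (1 : ℂ) (conj (q : ℂ) * p)
    rw [norm_one, norm_mul, Complex.norm_conj] at h5
    unfold defect
    nlinarith [norm_nonneg (q : ℂ), norm_nonneg (p : ℂ), q.norm_lt_one, p.norm_lt_one]
  have h6 := defect_pos q
  have h7 : 0 < ‖1 - conj (q : ℂ) * p‖ ^ 2 := by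
    have : 0 < ‖1 - conj (q : ℂ) * p‖ := by linarith
    positivity
  rw [h1, le_div_iff₀ h7] at h2
  have h8 : (defect q / 2) ^ 2 ≤ ‖1 - conj (q : ℂ) * p‖ ^ 2 := by gcongr
  have h9 : defect q * defect p ≤ defect p :=
    mul_le_of_le_one_left (defect_pos p).le (defect_le_one q)
  change 7 / 16 * ‖1 - conj (q : ℂ) * p‖ ^ 2 ≤ defect q * defect p at h2
  nlinarith

/-! ### Pseudo-hyperbolic estimates for analytic functions -/

/-- Take `h = f ∘ σ_p`. Since `σ_p` is an involution, `f = h ∘ σ_p`, which moves `p` to the origin;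
the derivative formula is the chain rule, and surjectivity carries bounds on `f` over to `h`. -/
theorem exists_pullback {f : 𝔻 → ℂ} (hf : Holo f) (p : 𝔻) :
    ∃ h : ℂ → ℂ, DifferentiableOn ℂ h (Metric.ball 0 1) ∧ (∀ w, h (σ p w) = f w) ∧
      (∀ w, invDeriv f w = deriv h (σ p w) * invDeriv (σ p) w) ∧
      ∀ ζ ∈ Metric.ball (0 : ℂ) 1, ∃ w, σ p w = ζ := by
  have hd : DifferentiableOn ℂ (fun ζ => ext f (mob p ζ)) (Metric.ball 0 1) := by
    intro ζ hζ
    rw [mem_ball_zero_iff] at hζ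
    refine DifferentiableAt.differentiableWithinAt ?_
    refine DifferentiableAt.comp (g := ext f) (f := mob p) ζ ?_
      (hasDerivAt_mob p.norm_lt_one hζ).differentiableAt
    exact DifferentiableOn.differentiableAt hf (Metric.isOpen_ball.mem_nhds
      (mem_ball_zero_iff.2 (norm_mob_lt_one p.norm_lt_one hζ)))
  have hv : ∀ w, ext f (mob p (σ p w)) = f w := fun w => by
    rw [σ_eq_mob, mob_mob p.norm_lt_one w.norm_lt_one, ext_coe]
  refine ⟨_, hd, hv, fun w => ?_, fun ζ hζ => ?_⟩
  · have hw := norm_mob_lt_one p.norm_lt_one w.norm_lt_one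
    have h1 := (hd.differentiableAt
      (Metric.isOpen_ball.mem_nhds (mem_ball_zero_iff.2 hw))).hasDerivAt
    have h2 := hasDerivAt_ext (f := f) (fun w => (hv w).symm)
      (h1.comp (w : ℂ) (hasDerivAt_mob p.norm_lt_one w.norm_lt_one))
    have h3 := hasDerivAt_ext (f := σ p) (fun _ => rfl)
      (hasDerivAt_mob p.norm_lt_one w.norm_lt_one)
    unfold invDeriv
    rw [show dderiv f w = _ from h2.deriv, show dderiv (σ p) w = _ from h3.deriv, σ_eq_mob]
    ring
  · rw [mem_ball_zero_iff] at hζ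
    exact ⟨.mk (mob p ζ) (norm_mob_lt_one p.norm_lt_one hζ), mob_mob p.norm_lt_one hζ⟩

theorem norm_deriv_le_of_norm_le {h : ℂ → ℂ} {r s M : ℝ} (hs : 0 < s)
    (hd : DifferentiableOn ℂ h (Metric.ball 0 (r + s)))
    (hM : ∀ ζ ∈ Metric.ball (0 : ℂ) (r + s), ‖h ζ‖ ≤ M) {ζ : ℂ} (hζ : ζ ∈ Metric.ball (0 : ℂ) r) :
    ‖deriv h ζ‖ ≤ M / s := by
  have hsub : Metric.closedBall ζ s ⊆ Metric.ball 0 (r + s) := fun x hx => by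
    rw [Metric.mem_ball] at *
    rw [Metric.mem_closedBall] at hx
    linarith [dist_triangle x ζ 0]
  exact Complex.norm_deriv_le_of_forall_mem_sphere_norm_le hs (hd.diffContOnCl_ball hsub)
    fun z hz => hM z (hsub (Metric.sphere_subset_closedBall hz))

/-- `f` is bounded by `M` on the pseudo-hyperbolic disc of radius `3 / 4` about `p`. -/
def LocBdd (f : 𝔻 → ℂ) (p : 𝔻) (M : ℝ) : Prop := ∀ w, pseudoDist w p < 3 / 4 → ‖f w‖ ≤ M

theorem LocBdd.norm_le {f : 𝔻 → ℂ} {p : 𝔻} {M : ℝ} (h : LocBdd f p M) : ‖f p‖ ≤ M :=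
  h p (by simp [pseudoDist, σ_self])

theorem LocBdd.nonneg {f : 𝔻 → ℂ} {p : 𝔻} {M : ℝ} (h : LocBdd f p M) : 0 ≤ M :=
  (norm_nonneg _).trans h.norm_le

/-- In the pulled-back picture `∂f(p) = -h'(0)`, and the last combination is `∂σ_p(q) (h'(σ_p q) -
h'(0))`. Two Cauchy estimates on the radii `3/4 > 11/16 > 5/8`, each losing `1/16`, bound `h'` by
`16 M` and `h''` by `256 M`; the mean value inequality does the rest. -/
theorem LocBdd.estimates {f : 𝔻 → ℂ} (hf : Holo f) {p : 𝔻} {M : ℝ} (hM : LocBdd f p M) :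
    ‖invDeriv f p‖ ≤ 16 * M ∧ ∀ q, pseudoDist p q < 1 / 2 →
      ‖f p - f q‖ ≤ 16 * M * pseudoDist p q ∧
      ‖invDeriv (σ p) q * invDeriv f p + invDeriv f q‖ ≤ 256 * M * pseudoDist p q := by
  obtain ⟨h, hd, hv, hD, hs⟩ := exists_pullback hf p
  have hb : ∀ ζ ∈ Metric.ball (0 : ℂ) (11 / 16 + 1 / 16), ‖h ζ‖ ≤ M := by
    intro ζ hζ
    obtain ⟨w, rfl⟩ := hs ζ (Metric.ball_subset_ball (by norm_num) hζ)
    rw [hv]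
    refine hM w ?_
    rw [mem_ball_zero_iff] at hζ
    unfold pseudoDist
    linarith
  have hb1 : ∀ ζ ∈ Metric.ball (0 : ℂ) (5 / 8 + 1 / 16), ‖deriv h ζ‖ ≤ 16 * M := by
    intro ζ hζ
    have := norm_deriv_le_of_norm_le (r := 11 / 16) (s := 1 / 16) (by norm_num)
      (hd.mono (Metric.ball_subset_ball (by norm_num))) hb
      (Metric.ball_subset_ball (by norm_num) hζ)
    linarith
  have hb2 : ∀ ζ ∈ Metric.ball (0 : ℂ) (1 / 2), ‖deriv (deriv h) ζ‖ ≤ 256 * M := by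
    intro ζ hζ
    have := norm_deriv_le_of_norm_le (r := 5 / 8) (s := 1 / 16) (by norm_num)
      ((hd.deriv Metric.isOpen_ball).mono (Metric.ball_subset_ball (by norm_num))) hb1
      (Metric.ball_subset_ball (by norm_num) hζ)
    linarith
  have hnhds : ∀ ζ ∈ Metric.ball (0 : ℂ) (1 / 2), Metric.ball (0 : ℂ) 1 ∈ 𝓝 ζ := fun ζ hζ =>
    Metric.isOpen_ball.mem_nhds (Metric.ball_subset_ball (by norm_num) hζ)
  have h0 : (0 : ℂ) ∈ Metric.ball (0 : ℂ) (1 / 2) := by simp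
  have hp : invDeriv f p = -deriv h 0 := by
    rw [hD, invDeriv_σ_self, σ_self]
    ring
  have hfp : f p = h 0 := by rw [← hv, σ_self]
  refine ⟨?_, fun q hq => ?_⟩
  · rw [hp, norm_neg]
    exact hb1 0 (by simp; norm_num)
  · have hq' : σ p q ∈ Metric.ball (0 : ℂ) (1 / 2) := by
      rw [mem_ball_zero_iff]
      rwa [pseudoDist_comm] at hq
    have e1 := (convex_ball (0 : ℂ) (1 / 2)).norm_image_sub_le_of_norm_deriv_le (f := h)
      (fun ζ hζ => hd.differentiableAt (hnhds ζ hζ))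
      (fun ζ hζ => hb1 ζ (Metric.ball_subset_ball (by norm_num) hζ)) hq' h0
    have e2 := (convex_ball (0 : ℂ) (1 / 2)).norm_image_sub_le_of_norm_deriv_le (f := deriv h)
      (fun ζ hζ => (hd.deriv Metric.isOpen_ball).differentiableAt (hnhds ζ hζ)) hb2 h0 hq'
    rw [zero_sub, norm_neg] at e1
    rw [sub_zero] at e2
    have hρ : ‖σ p q‖ = pseudoDist p q := (pseudoDist_comm p q).symm
    rw [hρ] at e1 e2
    refine ⟨by rw [hfp, ← hv q]; exact e1, ?_⟩
    rw [hp, hD q, show invDeriv (σ p) q * -deriv h 0 + deriv h (σ p q) * invDeriv (σ p) q =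
      invDeriv (σ p) q * (deriv h (σ p q) - deriv h 0) by ring, norm_mul]
    refine (mul_le_of_le_one_left (norm_nonneg _) ?_).trans e2
    rw [norm_invDeriv_σ]
    linarith [sq_nonneg ‖σ p q‖]

theorem norm_sub_le_of_locBdd {f : 𝔻 → ℂ} (hf : Holo f) {p q : 𝔻} {M : ℝ}
    (hp : LocBdd f p M) (hq : LocBdd f q M) : ‖f p - f q‖ ≤ 16 * M * pseudoDist p q := by
  by_cases h : pseudoDist p q < 1 / 2
  · exact ((hp.estimates hf).2 q h).1
  -- For `ρ ≥ 1/2` the trivial bound `2 M` is already at most `16 M ρ`.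
  · have h1 := norm_sub_le (f p) (f q)
    nlinarith [hp.norm_le, hq.norm_le, hp.nonneg]

theorem norm_invDeriv_add_le_of_locBdd {f : 𝔻 → ℂ} (hf : Holo f) {p q : 𝔻} {M : ℝ}
    (hp : LocBdd f p M) (hq : LocBdd f q M) :
    ‖invDeriv (σ p) q * invDeriv f p + invDeriv f q‖ ≤ 256 * M * pseudoDist p q := by
  by_cases h : pseudoDist p q < 1 / 2
  · exact ((hp.estimates hf).2 q h).2
  · have h1 := norm_add_le (invDeriv (σ p) q * invDeriv f p) (invDeriv f q)
    have h2 : ‖invDeriv (σ p) q * invDeriv f p‖ ≤ ‖invDeriv f p‖ := by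
      rw [norm_mul]
      refine mul_le_of_le_one_left (norm_nonneg _) ?_
      rw [norm_invDeriv_σ]
      linarith [sq_nonneg ‖σ p q‖]
    nlinarith [(hp.estimates hf).1, (hq.estimates hf).1, hp.nonneg]

/-! ### The difference of two weighted composition operators at a point -/

theorem invDeriv_testFun_zero_zero (a b w : 𝔻) :
    invDeriv (testFun 0 0 a b) w = invDeriv (σ a) w := by
  have h : testFun 0 0 a b = σ a - (a : ℂ) • 1 := by
    funext z
    simp [testFun]
  rw [h, invDeriv_sub (Holo.σ a) (Holo.one.smul _), invDeriv_smul _ Holo.one, invDeriv_one]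
  ring

theorem Holo.σ_sub_smul_one (a : 𝔻) : Holo (BlochDiff.σ a - (a : ℂ) • 1) :=
  (Holo.σ a).sub (Holo.one.smul _)

theorem invDeriv_testFun_zero_one (a b w : 𝔻) :
    invDeriv (testFun 0 1 a b) w =
      invDeriv (σ a) w * σ b w + (σ a w - a) * invDeriv (σ b) w := by
  have h : testFun 0 1 a b = testFun 0 0 a b * σ b := by
    funext z
    simp [testFun]
  have h0 : Holo (testFun 0 0 a b) := by
    simpa [testFun] using Holo.σ_sub_smul_one a
  rw [h, invDeriv_mul h0 (Holo.σ b), invDeriv_testFun_zero_zero]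
  simp [testFun]

theorem Holo.testFun (n m : ℕ) (a b : 𝔻) : Holo (testFun n m a b) :=
  (((Holo.σ a).pow _).sub (((Holo.σ a).pow _).smul _)).mul ((Holo.σ b).pow _)

theorem invDeriv_testFun_zero_two (a b w : 𝔻) :
    invDeriv (testFun 0 2 a b) w =
      invDeriv (σ a) w * σ b w ^ 2 + (σ a w - a) * (2 * σ b w * invDeriv (σ b) w) := by
  have h : testFun 0 2 a b = testFun 0 1 a b * σ b := by
    funext z
    simp [testFun]
    ring
  rw [h, invDeriv_mul (Holo.testFun 0 1 a b) (Holo.σ b), invDeriv_testFun_zero_one]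
  simp [testFun]
  ring

theorem invDeriv_testFun_one_two (a b w : 𝔻) :
    invDeriv (testFun 1 2 a b) w =
      (2 * σ a w - a) * invDeriv (σ a) w * σ b w ^ 2 +
        (σ a w - a) * σ a w * (2 * σ b w * invDeriv (σ b) w) := by
  have h : testFun 1 2 a b = testFun 0 2 a b * σ a := by
    funext z
    simp [testFun]
    ring
  rw [h, invDeriv_mul (Holo.testFun 0 2 a b) (Holo.σ a), invDeriv_testFun_zero_two]
  simp [testFun]
  ring

/-- The functional `f ↦ A f(p) + C (1 - |p|²) f'(p)`. -/
def jet (A C : ℂ) (p : 𝔻) (f : 𝔻 → ℂ) : ℂ := A * f p + C * invDeriv f p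

theorem jet_testFun_zero_two_left (A C : ℂ) (p q : 𝔻) :
    jet A C p (testFun 0 2 p q) =
      -(A * p * σ q p ^ 2 + C * (σ q p ^ 2 + 2 * p * σ q p * invDeriv (σ q) p)) := by
  unfold jet
  rw [invDeriv_testFun_zero_two, invDeriv_σ_self, σ_self]
  simp [testFun, σ_self]
  ring

/-- The extra factor `σ_p` vanishes at `p`, so `A` drops out and the test isolates `C`. -/
theorem jet_testFun_one_two_left (A C : ℂ) (p q : 𝔻) :
    jet A C p (testFun 1 2 p q) = C * p * σ q p ^ 2 := by
  unfold jet
  rw [invDeriv_testFun_one_two, invDeriv_σ_self, σ_self]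
  simp [testFun, σ_self]
  ring

/-- `σ_q²` has a double zero at `q`, which removes both the value and the derivative there; this is
the purpose of the exponent `m = 2`. -/
theorem jet_testFun_zero_two_right (B D : ℂ) (p q : 𝔻) :
    jet B D q (testFun 0 2 p q) = 0 := by
  unfold jet
  rw [invDeriv_testFun_zero_two, σ_self]
  simp [testFun, σ_self]

theorem jet_testFun_one_two_right (B D : ℂ) (p q : 𝔻) :
    jet B D q (testFun 1 2 p q) = 0 := by
  unfold jet
  rw [invDeriv_testFun_one_two, σ_self]
  simp [testFun, σ_self]

/-- The hypotheses `h1`, `h2`, `h3` are the tests (1,2) and (0,2) in absolute values, and `h1` gives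
`C ρ² ≤ 2η`. If `ρ < δ`, then `Aρ` is small by `hsmall`, and `h3` contains a term comparable to
`Cρ`. If `ρ ≥ δ`, dividing by `δ²` makes `C` itself small, and `h2` then bounds `Aρ²` by a multiple
of `ερ`. -/
theorem real_small_of_tests {A C P ρ ε δ η : ℝ} (hA : 0 ≤ A) (hC : 0 ≤ C) (hP : 1 / 2 ≤ P)
    (hP1 : P ≤ 1) (hρ : 0 ≤ ρ) (hρ1 : ρ ≤ 1) (hδ : 0 < δ) (hδ1 : δ ≤ 1 / 2)
    (hsmall : ρ < δ → A * ρ ≤ ε) (hε : 0 ≤ ε) (hη : η ≤ ε * δ ^ 2) (h1 : C * P * ρ ^ 2 ≤ η)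
    (h2 : A * P * ρ ^ 2 ≤ η + C * (ρ ^ 2 + 2 * P * ρ * (1 - ρ ^ 2)))
    (h3 : C * (2 * P * ρ * (1 - ρ ^ 2)) ≤ η + A * P * ρ ^ 2 + C * ρ ^ 2) :
    A * ρ ≤ 20 * ε ∧ C * ρ ≤ 20 * ε := by
  have h4 : C * ρ ^ 2 ≤ 2 * η := by
    have : 0 ≤ C * ρ ^ 2 * (P - 1 / 2) := by
      have : 0 ≤ P - 1 / 2 := by linarith
      positivity
    nlinarith
  rcases lt_or_ge ρ δ with h | h
  · have h5 := hsmall h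
    refine ⟨by linarith, ?_⟩
    have h6 : A * P * ρ ^ 2 ≤ ε := by
      have : A * P * ρ ^ 2 = A * ρ * (P * ρ) := by ring
      rw [this]
      have h7 : P * ρ ≤ 1 := by nlinarith
      have h8 : 0 ≤ A * ρ := by positivity
      nlinarith
    have h9 : η ≤ ε := hη.trans (mul_le_of_le_one_right hε (by nlinarith))
    have h10 : C * ρ * (3 / 4) ≤ C * (2 * P * ρ * (1 - ρ ^ 2)) := by
      have h11 : 3 / 4 ≤ 2 * P * (1 - ρ ^ 2) := by
        have : 3 / 4 ≤ 1 - ρ ^ 2 := by nlinarith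
        nlinarith
      have h12 : 0 ≤ C * ρ := by positivity
      calc C * ρ * (3 / 4) ≤ C * ρ * (2 * P * (1 - ρ ^ 2)) := by gcongr
        _ = _ := by ring
    linarith
  · have h5 : C ≤ 2 * ε := by
      have : C * δ ^ 2 ≤ 2 * ε * δ ^ 2 := by
        calc C * δ ^ 2 ≤ C * ρ ^ 2 := by gcongr
          _ ≤ _ := by linarith
      exact le_of_mul_le_mul_right this (by positivity)
    refine ⟨?_, by nlinarith⟩
    have hρ0 : 0 < ρ := hδ.trans_le h
    -- `δ² ≤ δ ≤ ρ`; the factor `ρ` is what allows one power of `ρ` to be cancelled at the end.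
    have h6 : η ≤ ε * ρ := by
      have : δ ^ 2 ≤ ρ := by nlinarith
      nlinarith
    have h7 : C * (ρ ^ 2 + 2 * P * ρ * (1 - ρ ^ 2)) ≤ 2 * ε * (3 * ρ) := by
      have h8 : ρ ^ 2 ≤ ρ := by nlinarith
      have h9 : 2 * P * ρ * (1 - ρ ^ 2) ≤ 2 * ρ := by
        have : P * (1 - ρ ^ 2) ≤ 1 := by nlinarith [sq_nonneg ρ]
        nlinarith
      have h10 : 0 ≤ 2 * P * ρ * (1 - ρ ^ 2) := by
        have : 0 ≤ 1 - ρ ^ 2 := by nlinarith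
        positivity
      calc C * (ρ ^ 2 + 2 * P * ρ * (1 - ρ ^ 2)) ≤ C * (3 * ρ) := by gcongr; linarith
        _ ≤ _ := by gcongr
    have h11 : A * ρ * ρ ≤ 14 * ε * ρ := by
      have : 0 ≤ A * ρ ^ 2 * (P - 1 / 2) := by
        have : 0 ≤ P - 1 / 2 := by linarith
        positivity
      nlinarith
    have h12 := le_of_mul_le_mul_right h11 hρ0
    linarith

theorem small_of_tests {A C : ℂ} {p q : 𝔻} {ε δ η : ℝ} (hp : 1 / 2 ≤ ‖(p : ℂ)‖) (hδ : 0 < δ)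
    (hδ1 : δ ≤ 1 / 2) (hsmall : pseudoDist p q < δ → ‖A‖ * pseudoDist p q ≤ ε) (hε : 0 ≤ ε)
    (hη : η ≤ ε * δ ^ 2) (h1 : ‖jet A C p (testFun 1 2 p q)‖ ≤ η)
    (h2 : ‖jet A C p (testFun 0 2 p q)‖ ≤ η) :
    ‖A‖ * pseudoDist p q ≤ 20 * ε ∧ ‖C‖ * pseudoDist p q ≤ 20 * ε := by
  rw [jet_testFun_one_two_left, norm_mul, norm_mul, norm_pow] at h1
  rw [jet_testFun_zero_two_left, norm_neg] at h2
  have hl : ‖invDeriv (σ q) p‖ = 1 - pseudoDist p q ^ 2 := norm_invDeriv_σ q p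
  have e1 : ‖A * p * σ q p ^ 2‖ = ‖A‖ * ‖(p : ℂ)‖ * pseudoDist p q ^ 2 := by
    rw [norm_mul, norm_mul, norm_pow]
    rfl
  have e2 : ‖C * (2 * p * σ q p * invDeriv (σ q) p)‖ =
      ‖C‖ * (2 * ‖(p : ℂ)‖ * pseudoDist p q * (1 - pseudoDist p q ^ 2)) := by
    rw [norm_mul, norm_mul, norm_mul, norm_mul, hl, Complex.norm_two]
    rfl
  have e3 : ‖C * σ q p ^ 2‖ = ‖C‖ * pseudoDist p q ^ 2 := by
    rw [norm_mul, norm_pow]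
    rfl
  set X := A * p * σ q p ^ 2
  set Y := C * (2 * p * σ q p * invDeriv (σ q) p)
  set Z := C * σ q p ^ 2
  have h3 : ‖X + (Z + Y)‖ ≤ η := by
    rwa [show X + (Z + Y) = A * p * σ q p ^ 2 +
      C * (σ q p ^ 2 + 2 * p * σ q p * invDeriv (σ q) p) by simp only [X, Y, Z]; ring]
  have h4 : ‖X‖ ≤ ‖X + (Z + Y)‖ + (‖Z‖ + ‖Y‖) := by
    have := norm_sub_le (X + (Z + Y)) (Z + Y)
    rw [add_sub_cancel_right] at this
    linarith [norm_add_le Z Y]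
  have h5 : ‖Y‖ ≤ ‖X + (Z + Y)‖ + ‖X‖ + ‖Z‖ := by
    have := norm_sub_le (X + (Z + Y)) (X + Z)
    rw [show X + (Z + Y) - (X + Z) = Y by ring] at this
    linarith [norm_add_le X Z]
  refine real_small_of_tests (norm_nonneg _) (norm_nonneg _) hp p.norm_lt_one.le
    (pseudoDist_nonneg p q) (pseudoDist_lt_one p q).le hδ hδ1 hsmall hε hη h1 ?_ ?_
  · rw [← e1, mul_add, ← e2, ← e3]
    linarith
  · rw [← e1, ← e2, ← e3]
    linarith

/-- The functional `f ↦ (1 - |z|²) (u C_φ f - v C_ψ f)'(z)` in terms of its coefficients. -/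
def jetDiff (A C B D : ℂ) (p q : 𝔻) (f : 𝔻 → ℂ) : ℂ := jet A C p f - jet B D q f

/-- In the test (0,1) the factor `σ_p` vanishes at `p`, leaving `p (C + D ∂σ_p(q))` up to terms
containing `Bρ` or `Dρ`. Once that is small, (0,0) controls `p (A - B)`; the bound `|p| ≥ 1/2`
permits division by `p`. -/
theorem norm_diff_le_of_tests {A B C D : ℂ} {p q : 𝔻} {κ : ℝ} (hp : 1 / 2 ≤ ‖(p : ℂ)‖)
    (hB : ‖B‖ * pseudoDist p q ≤ κ) (hD : ‖D‖ * pseudoDist p q ≤ κ)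
    (h0 : ‖jetDiff A C B D p q (testFun 0 0 p p)‖ ≤ κ)
    (h1 : ‖jetDiff A C B D p q (testFun 0 1 p p)‖ ≤ κ) :
    ‖A - B‖ ≤ 24 * κ ∧ ‖C + D * invDeriv (σ p) q‖ ≤ 24 * κ := by
  have hs : ‖σ p q‖ = pseudoDist p q := (pseudoDist_comm p q).symm
  have hs1 := (pseudoDist_lt_one p q).le
  have hp1 := p.norm_lt_one.le
  have hl : ‖invDeriv (σ p) q‖ ≤ 1 := by
    rw [norm_invDeriv_σ]
    linarith [sq_nonneg ‖σ p q‖]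
  have e0 : jetDiff A C B D p q (testFun 0 0 p p) =
      -(p * (A - B) + (C + D * invDeriv (σ p) q) + B * σ p q) := by
    unfold jetDiff jet
    rw [invDeriv_testFun_zero_zero, invDeriv_testFun_zero_zero, invDeriv_σ_self]
    simp [testFun, σ_self]
    ring
  have e1 : jetDiff A C B D p q (testFun 0 1 p p) =
      p * (C + D * invDeriv (σ p) q) -
        (B * σ p q * (σ p q - p) + D * σ p q * (2 * invDeriv (σ p) q)) := by
    unfold jetDiff jet
    rw [invDeriv_testFun_zero_one, invDeriv_testFun_zero_one, invDeriv_σ_self]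
    simp [testFun, σ_self]
    ring
  rw [e0, norm_neg] at h0
  rw [e1] at h1
  have hBs : ‖B * σ p q‖ ≤ κ := by rwa [norm_mul, hs]
  have hDs : ‖D * σ p q‖ ≤ κ := by rwa [norm_mul, hs]
  have hκ : 0 ≤ κ := (norm_nonneg _).trans hBs
  have t1 : ‖B * σ p q * (σ p q - p)‖ ≤ κ * 2 := by
    rw [norm_mul]
    gcongr
    linarith [norm_sub_le (σ p q) (p : ℂ)]
  have t2 : ‖D * σ p q * (2 * invDeriv (σ p) q)‖ ≤ κ * 2 := by
    rw [norm_mul, norm_mul 2, Complex.norm_two]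
    gcongr
    linarith
  set E := C + D * invDeriv (σ p) q
  have t3 : ‖(p : ℂ)‖ * ‖E‖ ≤ 5 * κ := by
    have t4 := norm_add_le (B * σ p q * (σ p q - p)) (D * σ p q * (2 * invDeriv (σ p) q))
    have t5 := norm_sub_norm_le (p * E)
      (B * σ p q * (σ p q - p) + D * σ p q * (2 * invDeriv (σ p) q))
    rw [norm_mul (p : ℂ)] at t5
    linarith
  have t6 : ‖E‖ ≤ 10 * κ := by nlinarith [norm_nonneg E]
  have t7 : ‖(p : ℂ)‖ * ‖A - B‖ ≤ 12 * κ := by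
    have t8 := norm_sub_le (p * (A - B) + E + B * σ p q) (E + B * σ p q)
    rw [show p * (A - B) + E + B * σ p q - (E + B * σ p q) = p * (A - B) by ring, norm_mul] at t8
    linarith [norm_add_le E (B * σ p q)]
  exact ⟨by nlinarith [norm_nonneg (A - B)], by linarith⟩

/-- The test functions `1`, `σ_p`, `σ_p²`, `σ_q σ_p²` lie in the unit ball. Up to terms with a
factor `Bρ`, they isolate `A - B`, `C + D ∂σ_p(q)`, `2 D ρ (1 - ρ²)` and `D ρ²` in absolute value.
-/
theorem bounds_of_bounded {A B C D : ℂ} {p q : 𝔻} {K : ℝ} (hB : ‖B‖ * pseudoDist p q ≤ K)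
    (h : ∀ f, Holo f → (∀ z, ‖f z‖ ≤ 1) → ‖jetDiff A C B D p q f‖ ≤ K) :
    ‖A - B‖ ≤ 2 * K ∧ ‖C + D * invDeriv (σ p) q‖ ≤ 2 * K ∧ ‖D‖ * pseudoDist p q ≤ 2 * K := by
  have hs : ‖σ p q‖ = pseudoDist p q := (pseudoDist_comm p q).symm
  have hρ := pseudoDist_nonneg p q
  have hρ1 := (pseudoDist_lt_one p q).le
  have hl : ‖invDeriv (σ p) q‖ = 1 - pseudoDist p q ^ 2 := by rw [norm_invDeriv_σ, hs]
  have hBs : ‖B * σ p q‖ ≤ K := by rwa [norm_mul, hs]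
  have hK : 0 ≤ K := (norm_nonneg _).trans hBs
  have e0 : jetDiff A C B D p q 1 = A - B := by
    simp [jetDiff, jet, invDeriv_one]
  have e1 : jetDiff A C B D p q (σ p) = -(C + D * invDeriv (σ p) q) - B * σ p q := by
    simp [jetDiff, jet, invDeriv_σ_self, σ_self]
    ring
  have e2 : jetDiff A C B D p q (σ p * σ p) =
      -(2 * (D * σ p q * invDeriv (σ p) q)) - B * σ p q * σ p q := by
    unfold jetDiff jet
    rw [invDeriv_mul (Holo.σ p) (Holo.σ p), invDeriv_mul (Holo.σ p) (Holo.σ p)]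
    simp [σ_self]
    ring
  have e3 : jetDiff A C B D p q (σ q * (σ p * σ p)) = D * σ p q * σ p q := by
    unfold jetDiff jet
    rw [invDeriv_mul (Holo.σ q) ((Holo.σ p).mul (Holo.σ p)),
      invDeriv_mul (Holo.σ q) ((Holo.σ p).mul (Holo.σ p)), invDeriv_mul (Holo.σ p) (Holo.σ p),
      invDeriv_σ_self q]
    simp [σ_self]
    ring
  have hpp : ∀ z, ‖(σ p * σ p) z‖ ≤ 1 := fun z => by
    rw [Pi.mul_apply, norm_mul]
    exact mul_le_one₀ (norm_σ_le_one p z) (norm_nonneg _) (norm_σ_le_one p z)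
  have h0 := h 1 Holo.one fun z => by simp
  have h1 := h (σ p) (Holo.σ p) (norm_σ_le_one p)
  have h2 := h (σ p * σ p) ((Holo.σ p).mul (Holo.σ p)) hpp
  have h3 := h (σ q * (σ p * σ p)) ((Holo.σ q).mul ((Holo.σ p).mul (Holo.σ p))) fun z => by
    rw [Pi.mul_apply, norm_mul]
    exact mul_le_one₀ (norm_σ_le_one q z) (norm_nonneg _) (hpp z)
  rw [e0] at h0
  rw [e1] at h1
  rw [e2] at h2
  rw [e3, norm_mul, norm_mul, hs] at h3
  refine ⟨by linarith, ?_, ?_⟩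
  · have := norm_sub_norm_le (-(C + D * invDeriv (σ p) q)) (B * σ p q)
    rw [norm_neg] at this
    linarith
  · have t1 := norm_sub_norm_le (-(2 * (D * σ p q * invDeriv (σ p) q))) (B * σ p q * σ p q)
    rw [norm_neg, norm_mul, norm_mul (D * σ p q), hl, Complex.norm_two, norm_mul D,
      norm_mul (B * σ p q), hs] at t1
    have t2 : ‖B * σ p q‖ * pseudoDist p q ≤ K := by nlinarith [norm_nonneg (B * σ p q)]
    have hDn : 0 ≤ ‖D‖ * pseudoDist p q := by positivity
    -- `Dρ = Dρ(1 - ρ²) + ρ · Dρ²` in absolute values, and each summand is at most `K`.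
    nlinarith

theorem norm_jetDiff_le {A B C D : ℂ} {p q : 𝔻} {κ M : ℝ} {f : 𝔻 → ℂ} (hf : Holo f)
    (hAB : ‖A - B‖ ≤ κ) (hB : ‖B‖ * pseudoDist p q ≤ κ)
    (hCD : ‖C + D * invDeriv (σ p) q‖ ≤ κ) (hD : ‖D‖ * pseudoDist p q ≤ κ)
    (hp : LocBdd f p M) (hq : LocBdd f q M) : ‖jetDiff A C B D p q f‖ ≤ 289 * (κ * M) := by
  have hκ : 0 ≤ κ := (norm_nonneg _).trans hAB
  have hM := hp.nonneg
  -- Each group pairs a controlled coefficient with a jet, or a coefficient controlled only after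
  -- multiplication by `ρ` with an `O(ρ)` difference; `289 = 1 + 16 + 16 + 256`.
  have e : jetDiff A C B D p q f = (A - B) * f p + B * (f p - f q) +
      (C + D * invDeriv (σ p) q) * invDeriv f p -
      D * (invDeriv (σ p) q * invDeriv f p + invDeriv f q) := by
    unfold jetDiff jet
    ring
  have t1 : ‖(A - B) * f p‖ ≤ κ * M := by
    rw [norm_mul]
    gcongr
    exact hp.norm_le
  have t2 : ‖B * (f p - f q)‖ ≤ 16 * (κ * M) := by
    rw [norm_mul]
    calc ‖B‖ * ‖f p - f q‖ ≤ ‖B‖ * (16 * M * pseudoDist p q) := by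
          gcongr
          exact norm_sub_le_of_locBdd hf hp hq
      _ = 16 * (‖B‖ * pseudoDist p q * M) := by ring
      _ ≤ _ := by gcongr
  have t3 : ‖(C + D * invDeriv (σ p) q) * invDeriv f p‖ ≤ κ * (16 * M) := by
    rw [norm_mul]
    gcongr
    exact (hp.estimates hf).1
  have t4 : ‖D * (invDeriv (σ p) q * invDeriv f p + invDeriv f q)‖ ≤ 256 * (κ * M) := by
    rw [norm_mul]
    calc ‖D‖ * ‖invDeriv (σ p) q * invDeriv f p + invDeriv f q‖
        ≤ ‖D‖ * (256 * M * pseudoDist p q) := by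
          gcongr
          exact norm_invDeriv_add_le_of_locBdd hf hp hq
      _ = 256 * (‖D‖ * pseudoDist p q * M) := by ring
      _ ≤ _ := by gcongr
  rw [e]
  refine (norm_sub_le _ _).trans ?_
  linarith [norm_add₃_le (a := (A - B) * f p) (b := B * (f p - f q))
    (c := (C + D * invDeriv (σ p) q) * invDeriv f p)]

/-- When `ρ` is bounded below, no cancellation between the two points is needed and each jet can be
estimated alone. -/
theorem norm_jet_le {A C : ℂ} {p q : 𝔻} {κ M : ℝ} {f : 𝔻 → ℂ} (hf : Holo f)
    (hρ : 1 / 2 ≤ pseudoDist p q) (hA : ‖A‖ * pseudoDist p q ≤ κ)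
    (hC : ‖C‖ * pseudoDist p q ≤ κ) (hp : LocBdd f p M) : ‖jet A C p f‖ ≤ 34 * (κ * M) := by
  have hM := hp.nonneg
  have hA' : ‖A‖ ≤ 2 * κ := by nlinarith [norm_nonneg A]
  have hC' : ‖C‖ ≤ 2 * κ := by nlinarith [norm_nonneg C]
  have hκ : 0 ≤ κ := by linarith [norm_nonneg A]
  unfold jet
  calc ‖A * f p + C * invDeriv f p‖ ≤ ‖A‖ * ‖f p‖ + ‖C‖ * ‖invDeriv f p‖ := by
        rw [← norm_mul, ← norm_mul]
        exact norm_add_le _ _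
    _ ≤ 2 * κ * M + 2 * κ * (16 * M) := by
        gcongr
        · exact hp.norm_le
        · exact (hp.estimates hf).1
    _ = _ := by ring

/-! ### The Bloch seminorm and the approach to the boundary -/

theorem blochSemi_eq (f : 𝔻 → ℂ) : blochSemi f = ⨆ z, ENNReal.ofReal ‖invDeriv f z‖ := by
  refine iSup_congr fun z => ?_
  rw [invDeriv, norm_mul, Complex.norm_of_nonneg (defect_pos z).le]
  rfl

theorem blochSemi_le_ofReal {f : 𝔻 → ℂ} {ε : ℝ} (h : ∀ z, ‖invDeriv f z‖ ≤ ε) :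
    blochSemi f ≤ ENNReal.ofReal ε := by
  rw [blochSemi_eq]
  exact iSup_le fun z => ENNReal.ofReal_le_ofReal (h z)

theorem norm_invDeriv_le_of_blochSemi_le {f : 𝔻 → ℂ} {ε : ℝ} (hε : 0 ≤ ε)
    (h : blochSemi f ≤ ENNReal.ofReal ε) (z : 𝔻) : ‖invDeriv f z‖ ≤ ε := by
  rw [blochSemi_eq] at h
  exact (ENNReal.ofReal_le_ofReal_iff hε).1 ((le_iSup _ z).trans h)

theorem Bloch.blochSemi_le (g : Bloch) : blochSemi g.toFun ≤ ENNReal.ofReal ‖g‖ := by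
  rw [← ENNReal.ofReal_toReal g.semi_lt_top.ne]
  exact ENNReal.ofReal_le_ofReal (le_add_of_nonneg_left (norm_nonneg _))

theorem Bloch.norm_invDeriv_le (g : Bloch) (z : 𝔻) : ‖invDeriv g.toFun z‖ ≤ ‖g‖ :=
  norm_invDeriv_le_of_blochSemi_le (norm_nonneg g) g.blochSemi_le z

theorem Bloch.norm_le {g : Bloch} {ε η : ℝ} (h0 : ‖g.toFun 0‖ ≤ ε) (hη : 0 ≤ η)
    (h : ∀ z, ‖invDeriv g.toFun z‖ ≤ η) : ‖g‖ ≤ ε + η := by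
  rw [Bloch.norm_def]
  exact add_le_add h0 (ENNReal.toReal_le_of_le_ofReal hη (blochSemi_le_ofReal h))

theorem exists_defect_of_eventually {P : 𝔻 → Prop} (h : ∀ᶠ a in toBoundary, P a) :
    ∃ r > 0, ∀ a, defect a < r → P a := by
  obtain ⟨s, hs, hP⟩ := (Metric.nhds_basis_ball.comap _).eventually_iff.1 h
  refine ⟨s, hs, fun a ha => hP ?_⟩
  have h1 := a.norm_lt_one
  rw [Set.mem_preimage, Metric.mem_ball, Real.dist_eq, abs_sub_comm, abs_of_pos (by linarith)]
  unfold defect at ha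
  nlinarith [norm_nonneg (a : ℂ)]

theorem tendsto_defect_toBoundary : Tendsto defect toBoundary (𝓝 0) := by
  have h : Tendsto (fun t : ℝ => 1 - t ^ 2) (𝓝 1) (𝓝 0) := by
    have : Continuous fun t : ℝ => 1 - t ^ 2 := by fun_prop
    simpa using this.tendsto 1
  exact h.comp tendsto_comap

/-! ### Functions that are small on compact sets have small images -/

/-- The coefficient `(1 - |z|²) u(z) φ'(z) / (1 - |φ(z)|²)` of a weighted composition operator. -/
def compCoeff (u : 𝔻 → ℂ) (φ : 𝔻 → 𝔻) (z : 𝔻) : ℂ :=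
  u z * invDeriv (fun z => (φ z : ℂ)) z / defect (φ z)

theorem invDeriv_wComp {u f : 𝔻 → ℂ} {φ : 𝔻 → 𝔻} (hu : Holo u)
    (hφ : Holo (fun z => (φ z : ℂ))) (hf : Holo f) (z : 𝔻) :
    invDeriv (wComp u φ f) z = jet (invDeriv u z) (compCoeff u φ z) (φ z) f := by
  have h : (defect (φ z) : ℂ) ≠ 0 := Complex.ofReal_ne_zero.2 (defect_pos _).ne'
  unfold jet compCoeff invDeriv
  rw [show dderiv (wComp u φ f) z = _ from (hasDerivAt_ext_wComp hu hφ hf z).deriv]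
  field_simp

theorem weight_eq (φ ψ : 𝔻 → 𝔻) (u : 𝔻 → ℂ) (z : 𝔻) :
    weight φ ψ u z = ‖invDeriv u z‖ * pseudoDist (φ z) (ψ z) := by
  rw [invDeriv, norm_mul, Complex.norm_of_nonneg (defect_pos z).le]
  rfl

theorem exists_delta_of_tendsto_weight {φ ψ : 𝔻 → 𝔻} {u : 𝔻 → ℂ}
    (h : Tendsto (weight φ ψ u) (rhoToZero φ ψ) (𝓝 0)) {ε : ℝ} (hε : 0 < ε) :
    ∃ δ > 0, δ ≤ 1 / 2 ∧ ∀ z, pseudoDist (φ z) (ψ z) < δ →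
      ‖invDeriv u z‖ * pseudoDist (φ z) (ψ z) ≤ ε := by
  obtain ⟨s, hs, hP⟩ := (Metric.nhds_basis_ball.comap _).eventually_iff.1
    (h.eventually_lt_const hε)
  refine ⟨min s (1 / 2), by positivity, min_le_right _ _, fun z hz => ?_⟩
  rw [← weight_eq]
  refine (hP ?_).le
  rw [Set.mem_preimage, Metric.mem_ball, Real.dist_eq, sub_zero,
    abs_of_nonneg (pseudoDist_nonneg _ _)]
  exact hz.trans_le (min_le_left _ _)

theorem half_le_norm_of_defect_lt {p : 𝔻} (h : defect p < 3 / 4) : 1 / 2 ≤ ‖(p : ℂ)‖ := by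
  unfold defect at h
  nlinarith [norm_nonneg (p : ℂ)]

/-- The difference of two weighted composition operators has small values on the test functions
with indices `(n, m)` as the first parameter tends to the boundary. -/
def TestVanish (u v : 𝔻 → ℂ) (φ ψ : 𝔻 → 𝔻) (n m : ℕ) : Prop :=
  Tendsto (fun a : 𝔻 => ⨆ b : 𝔻, blochSemi ((wComp u φ - wComp v ψ) (testFun n m a b)))
    toBoundary (𝓝 0)

/-- The functional `f ↦ (1 - |z|²) (u C_φ f - v C_ψ f)'(z)`. -/
def pointJet (u v : 𝔻 → ℂ) (φ ψ : 𝔻 → 𝔻) (z : 𝔻) (f : 𝔻 → ℂ) : ℂ :=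
  jetDiff (invDeriv u z) (compCoeff u φ z) (invDeriv v z) (compCoeff v ψ z) (φ z) (ψ z) f

section

variable {u v : 𝔻 → ℂ} {φ ψ : 𝔻 → 𝔻}

theorem invDeriv_wComp_sub (hu : Holo u) (hv : Holo v) (hφ : Holo (fun z => (φ z : ℂ)))
    (hψ : Holo (fun z => (ψ z : ℂ))) {f : 𝔻 → ℂ} (hf : Holo f) (z : 𝔻) :
    invDeriv ((wComp u φ - wComp v ψ) f) z = pointJet u v φ ψ z f := by
  rw [LinearMap.sub_apply, invDeriv_sub (hu.wComp hφ hf) (hv.wComp hψ hf),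
    invDeriv_wComp hu hφ hf, invDeriv_wComp hv hψ hf]
  rfl

theorem TestVanish.exists_defect (hu : Holo u) (hv : Holo v) (hφ : Holo (fun z => (φ z : ℂ)))
    (hψ : Holo (fun z => (ψ z : ℂ))) {n m : ℕ} (h : TestVanish u v φ ψ n m) {η : ℝ}
    (hη : 0 < η) :
    ∃ r > 0, ∀ a, defect a < r → ∀ b z, ‖pointJet u v φ ψ z (testFun n m a b)‖ ≤ η := by
  obtain ⟨r, hr, H⟩ := exists_defect_of_eventually
    (ENNReal.tendsto_nhds_zero.1 h (ENNReal.ofReal η) (ENNReal.ofReal_pos.2 hη))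
  refine ⟨r, hr, fun a ha b z => ?_⟩
  rw [← invDeriv_wComp_sub hu hv hφ hψ (Holo.testFun n m a b)]
  exact norm_invDeriv_le_of_blochSemi_le hη.le ((le_iSup _ b).trans (H a ha)) z

/-- Near the boundary, the test functions control all the coefficients. -/
theorem exists_defect_coeff_small (hu : Holo u) (hv : Holo v) (hφ : Holo (fun z => (φ z : ℂ)))
    (hψ : Holo (fun z => (ψ z : ℂ))) (hB : CondB u v φ ψ) (h02 : TestVanish u v φ ψ 0 2)
    (h12 : TestVanish u v φ ψ 1 2) {ε : ℝ} (hε : 0 < ε) :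
    ∃ r > 0, r ≤ 3 / 4 ∧ ∀ z,
      (defect (φ z) < r → ‖invDeriv u z‖ * pseudoDist (φ z) (ψ z) ≤ ε ∧
        ‖compCoeff u φ z‖ * pseudoDist (φ z) (ψ z) ≤ ε) ∧
      (defect (ψ z) < r → ‖invDeriv v z‖ * pseudoDist (φ z) (ψ z) ≤ ε ∧
        ‖compCoeff v ψ z‖ * pseudoDist (φ z) (ψ z) ≤ ε) := by
  have hε' : 0 < ε / 20 := by positivity
  obtain ⟨δ₁, hδ₁, hδ₁', H₁⟩ := exists_delta_of_tendsto_weight hB.1 hε'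
  obtain ⟨δ₂, hδ₂, hδ₂', H₂⟩ := exists_delta_of_tendsto_weight hB.2 hε'
  set η := ε / 20 * (min δ₁ δ₂) ^ 2
  have hm : 0 < min δ₁ δ₂ := lt_min hδ₁ hδ₂
  have hη : 0 < η := by positivity
  have hη₁ : η ≤ ε / 20 * δ₁ ^ 2 := by
    have := min_le_left δ₁ δ₂
    simp only [η]
    gcongr
  have hη₂ : η ≤ ε / 20 * δ₂ ^ 2 := by
    have := min_le_right δ₁ δ₂
    simp only [η]
    gcongr
  obtain ⟨r₁, hr₁, G₁⟩ := h02.exists_defect hu hv hφ hψ hη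
  obtain ⟨r₂, hr₂, G₂⟩ := h12.exists_defect hu hv hφ hψ hη
  refine ⟨min (min r₁ r₂) (3 / 4), by positivity, min_le_right _ _, fun z => ⟨fun h => ?_,
    fun h => ?_⟩⟩
  · rw [lt_min_iff, lt_min_iff] at h
    have g₁ := G₁ _ h.1.1 (ψ z) z
    have g₂ := G₂ _ h.1.2 (ψ z) z
    rw [pointJet, jetDiff, jet_testFun_zero_two_right, sub_zero] at g₁
    rw [pointJet, jetDiff, jet_testFun_one_two_right, sub_zero] at g₂
    have := small_of_tests (half_le_norm_of_defect_lt h.2) hδ₁ hδ₁' (H₁ z) hε'.le hη₁ g₂ g₁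
    rwa [mul_div_cancel₀ _ (by norm_num)] at this
  -- The same argument with the roles of `φ z` and `ψ z` exchanged: now `a = ψ z` and `b = φ z`.
  · rw [lt_min_iff, lt_min_iff] at h
    have g₁ := G₁ _ h.1.1 (φ z) z
    have g₂ := G₂ _ h.1.2 (φ z) z
    rw [pointJet, jetDiff, jet_testFun_zero_two_right, zero_sub, norm_neg] at g₁
    rw [pointJet, jetDiff, jet_testFun_one_two_right, zero_sub, norm_neg] at g₂
    have H := H₂ z
    rw [pseudoDist_comm (φ z)] at H ⊢
    have := small_of_tests (half_le_norm_of_defect_lt h.2) hδ₂ hδ₂' H hε'.le hη₂ g₂ g₁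
    rwa [mul_div_cancel₀ _ (by norm_num)] at this

theorem LocBdd.of_compact {f : 𝔻 → ℂ} {r δ : ℝ} (hr : 0 < r)
    (h : ∀ w, 7 / 64 * r ^ 2 ≤ defect w → ‖f w‖ ≤ δ) {p : 𝔻} (hp : r ≤ defect p) :
    LocBdd f p δ := fun w hw => h w <| by
  have := defect_le_of_pseudoDist hw
  nlinarith

/-- If both points are near the boundary, the coefficients are small. If both lie in a compact part,
`f` is small near them. If only one is near the boundary and `ρ < 1/2`, the other point keeps it in
a slightly larger compact part; if `ρ ≥ 1/2`, the jets separate, one having small coefficients and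
the other a small function. -/
theorem exists_compact_small (hu : Holo u) (hv : Holo v) (hφ : Holo (fun z => (φ z : ℂ)))
    (hψ : Holo (fun z => (ψ z : ℂ))) (hA : CondA u v φ ψ) (hB : CondB u v φ ψ) {K₀ : ℝ}
    (hK₀ : ∀ f, Holo f → (∀ z, ‖f z‖ ≤ 1) → ∀ z, ‖pointJet u v φ ψ z f‖ ≤ K₀)
    (h00 : TestVanish u v φ ψ 0 0) (h01 : TestVanish u v φ ψ 0 1)
    (h02 : TestVanish u v φ ψ 0 2) (h12 : TestVanish u v φ ψ 1 2) {ε : ℝ} (hε : 0 < ε) :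
    ∃ r > 0, ∃ δ > 0, ∀ f, Holo f → (∀ z, ‖f z‖ ≤ 2) →
      (∀ w, r ≤ defect w → ‖f w‖ ≤ δ) → ∀ z, ‖pointJet u v φ ψ z f‖ ≤ ε := by
  obtain ⟨K₁, hK₁⟩ := hA.1
  obtain ⟨K₂, hK₂⟩ := hA.2
  obtain ⟨K, hK, hAK, hBK, hK'⟩ : ∃ K > 0, (∀ z, ‖invDeriv u z‖ * pseudoDist (φ z) (ψ z) ≤ K) ∧
      (∀ z, ‖invDeriv v z‖ * pseudoDist (φ z) (ψ z) ≤ K) ∧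
      ∀ f, Holo f → (∀ z, ‖f z‖ ≤ 1) → ∀ z, ‖pointJet u v φ ψ z f‖ ≤ K := by
    refine ⟨|K₀| + |K₁| + |K₂| + 1, by positivity, fun z => ?_, fun z => ?_,
      fun f hf hf1 z => ?_⟩
    · rw [← weight_eq]
      linarith [hK₁ ⟨z, rfl⟩, le_abs_self K₁, abs_nonneg K₀, abs_nonneg K₂]
    · rw [← weight_eq]
      linarith [hK₂ ⟨z, rfl⟩, le_abs_self K₂, abs_nonneg K₀, abs_nonneg K₁]
    · linarith [hK₀ f hf hf1 z, le_abs_self K₀, abs_nonneg K₁, abs_nonneg K₂]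
  have hC : ∀ z, ‖compCoeff u φ z‖ * pseudoDist (φ z) (ψ z) ≤ 4 * K := fun z => by
    obtain ⟨-, b1, b2⟩ := bounds_of_bounded (hBK z) fun f hf hf1 => hK' f hf hf1 z
    set E := compCoeff v ψ z * invDeriv (σ (φ z)) (ψ z)
    have hE : ‖E‖ ≤ ‖compCoeff v ψ z‖ := by
      rw [norm_mul]
      refine mul_le_of_le_one_right (norm_nonneg _) ?_
      rw [norm_invDeriv_σ]
      linarith [sq_nonneg ‖σ (φ z) (ψ z)‖]
    have h1 : ‖compCoeff u φ z‖ ≤ 2 * K + ‖compCoeff v ψ z‖ := by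
      have := norm_sub_le (compCoeff u φ z + E) E
      rw [add_sub_cancel_right] at this
      linarith
    nlinarith [pseudoDist_nonneg (φ z) (ψ z), pseudoDist_lt_one (φ z) (ψ z)]
  -- When both points are near the boundary the bound is `289 · 24κ · 2 = 13872 κ`.
  set κ := ε / 20000
  have hκ : 0 < κ := by positivity
  obtain ⟨r₁, hr₁, hr₁', S₁⟩ := exists_defect_coeff_small hu hv hφ hψ hB h02 h12 hκ
  obtain ⟨r₂, hr₂, S₂⟩ := h00.exists_defect hu hv hφ hψ hκ
  obtain ⟨r₃, hr₃, S₃⟩ := h01.exists_defect hu hv hφ hψ hκ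
  set r := min r₁ (min r₂ r₃)
  have hr : 0 < r := by positivity
  have hrr₁ : r ≤ r₁ := min_le_left _ _
  have hrr₂ : r ≤ r₂ := (min_le_right _ _).trans (min_le_left _ _)
  have hrr₃ : r ≤ r₃ := (min_le_right _ _).trans (min_le_right _ _)
  -- A point within pseudo-hyperbolic distance `3/4` of `{defect ≥ r}` lies in `{defect ≥ s}`. The
  -- final radius `7/64 * s²` adds a second such layer, so that `f` is small on whole neighbourhoods
  -- of points of `{defect ≥ s}`.
  set s := 7 / 64 * r ^ 2
  have hs : 0 < s := by positivity
  have hsr : s ≤ r := by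
    have : r ≤ 3 / 4 := hrr₁.trans hr₁'
    simp only [s]
    nlinarith
  set δ := ε / (2000 * K)
  have hδ : 0 < δ := by positivity
  have hδK : K * δ = ε / 2000 := by
    simp only [δ]
    field_simp
  refine ⟨7 / 64 * s ^ 2, by positivity, δ, hδ, fun f hf hf2 hsmall z => ?_⟩
  have hloc : ∀ p : 𝔻, LocBdd f p 2 := fun p w _ => hf2 w
  have hlocδ : ∀ p : 𝔻, s ≤ defect p → LocBdd f p δ := fun p hp => LocBdd.of_compact hs hsmall hp
  have hboth : s ≤ defect (φ z) → s ≤ defect (ψ z) → ‖pointJet u v φ ψ z f‖ ≤ ε := by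
    intro h1 h2
    obtain ⟨b0, b1, b2⟩ := bounds_of_bounded (hBK z) fun f hf hf1 => hK' f hf hf1 z
    have := norm_jetDiff_le (κ := 2 * K) hf b0 ((hBK z).trans (by linarith)) b1 b2
      (hlocδ _ h1) (hlocδ _ h2)
    refine this.trans ?_
    rw [mul_assoc 2, hδK]
    linarith
  have hmixed : ∀ {p q : 𝔻} {A C B D : ℂ}, 1 / 2 ≤ pseudoDist p q →
      ‖A‖ * pseudoDist p q ≤ κ → ‖C‖ * pseudoDist p q ≤ κ → ‖B‖ * pseudoDist p q ≤ 4 * K →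
      ‖D‖ * pseudoDist p q ≤ 4 * K → r ≤ defect q → ‖jet A C p f‖ + ‖jet B D q f‖ ≤ ε := by
    intro p q A C B D hρ c1 c2 c3 c4 hq
    have t1 := norm_jet_le hf hρ c1 c2 (hloc p)
    rw [pseudoDist_comm] at hρ c3 c4
    have t2 := norm_jet_le hf hρ c3 c4 (hlocδ q (hsr.trans hq))
    rw [mul_assoc 4, hδK] at t2
    simp only [κ] at t1
    linarith
  rcases lt_or_ge (defect (φ z)) r with hp | hp <;> rcases lt_or_ge (defect (ψ z)) r with hq | hq
  · have c1 := (S₁ z).2 (hq.trans_le hrr₁)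
    obtain ⟨d1, d2⟩ := norm_diff_le_of_tests (half_le_norm_of_defect_lt
      (hp.trans_le (hrr₁.trans hr₁'))) c1.1 c1.2 (S₂ _ (hp.trans_le hrr₂) _ z)
      (S₃ _ (hp.trans_le hrr₃) _ z)
    refine (norm_jetDiff_le hf d1 (c1.1.trans (by linarith)) d2 (c1.2.trans (by linarith))
      (hloc _) (hloc _)).trans ?_
    simp only [κ]
    linarith
  · by_cases hρ : pseudoDist (φ z) (ψ z) < 1 / 2
    · refine hboth ?_ (hsr.trans hq)
      have := defect_le_of_pseudoDist (hρ.trans (by norm_num))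
      simp only [s]
      nlinarith
    · have c1 := (S₁ z).1 (hp.trans_le hrr₁)
      have b2 := (bounds_of_bounded (hBK z) fun f hf hf1 => hK' f hf hf1 z).2.2
      exact (norm_sub_le _ _).trans (hmixed (not_lt.1 hρ) c1.1 c1.2
        ((hBK z).trans (by linarith)) (b2.trans (by linarith)) hq)
  · by_cases hρ : pseudoDist (φ z) (ψ z) < 1 / 2
    · refine hboth (hsr.trans hp) ?_
      rw [pseudoDist_comm] at hρ
      have := defect_le_of_pseudoDist (hρ.trans (by norm_num))
      simp only [s]
      nlinarith
    · have c1 := (S₁ z).2 (hq.trans_le hrr₁)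
      have hC' := hC z
      have hA' := (hAK z).trans (show K ≤ 4 * K by linarith)
      rw [pseudoDist_comm] at hρ c1 hC' hA'
      refine (norm_sub_le _ _).trans ?_
      rw [add_comm]
      exact hmixed (not_lt.1 hρ) c1.1 c1.2 hA' hC' hp
  · exact hboth (hsr.trans hp) (hsr.trans hq)

end

/-! ### Normal families and compactness -/

theorem HInf.mem_closedBall {g : HInf} {r : ℝ} :
    g ∈ Metric.closedBall (0 : HInf) r ↔ ‖g‖ ≤ r := by
  rw [Metric.mem_closedBall, dist_zero_right g]

theorem HInf.locBdd (g : HInf) (hg : ‖g‖ ≤ 1) (p : 𝔻) : LocBdd (g : 𝔻 →ᵇ ℂ) p 1 :=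
  fun w _ => (HInf.norm_apply_le g w).trans hg

theorem HInf.norm_apply_sub_le (g : HInf) (hg : ‖g‖ ≤ 1) (p q : 𝔻) :
    ‖(g : 𝔻 →ᵇ ℂ) p - (g : 𝔻 →ᵇ ℂ) q‖ ≤ 16 * pseudoDist p q := by
  simpa using norm_sub_le_of_locBdd g.2 (HInf.locBdd g hg p) (HInf.locBdd g hg q)

/-- Montel's theorem for the unit ball of `H^∞`, in terms of ultrafilters. -/
theorem HInf.exists_limit (V : Ultrafilter HInf) (hV : Metric.closedBall 0 1 ∈ V) :
    ∃ f : HInf, ‖f‖ ≤ 1 ∧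
      (∀ z, Tendsto (fun g : HInf => (g : 𝔻 →ᵇ ℂ) z) V (𝓝 ((f : 𝔻 →ᵇ ℂ) z))) ∧
      ∀ r > 0, ∀ δ > 0, ∀ᶠ g : HInf in V, ∀ w, r ≤ defect w →
        ‖(g : 𝔻 →ᵇ ℂ) w - (f : 𝔻 →ᵇ ℂ) w‖ ≤ δ := by
  have hball : ∀ᶠ g : HInf in V, ‖g‖ ≤ 1 := by
    filter_upwards [hV] with g hg using HInf.mem_closedBall.1 hg
  have hlim : ∀ z : 𝔻, ∃ c ∈ Metric.closedBall (0 : ℂ) 1,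
      Tendsto (fun g : HInf => (g : 𝔻 →ᵇ ℂ) z) V (𝓝 c) := fun z =>
    isCompact_iff_ultrafilter_le_nhds.1 (isCompact_closedBall (0 : ℂ) 1)
      (V.map fun g : HInf => (g : 𝔻 →ᵇ ℂ) z) <| le_principal_iff.2 <| by
        refine Filter.mem_map.2 ?_
        filter_upwards [hball] with g hg
        simpa using (HInf.norm_apply_le g z).trans hg
  choose F hF1 hF using hlim
  -- The unit ball is equi-Lipschitz for `pseudoDist`, and the pointwise limit inherits the
  -- constant; this upgrades pointwise to locally uniform convergence.
  have hF2 : ∀ p q, ‖F p - F q‖ ≤ 16 * pseudoDist p q := fun p q =>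
    le_of_tendsto ((hF p).sub (hF q)).norm <| by
      filter_upwards [hball] with g hg using HInf.norm_apply_sub_le g hg p q
  have hloc : TendstoLocallyUniformlyOn (fun g : HInf => ext (g : 𝔻 →ᵇ ℂ)) (ext F) V
      (Metric.ball 0 1) := by
    rw [Metric.tendstoLocallyUniformlyOn_iff]
    intro ε hε w hw
    rw [mem_ball_zero_iff] at hw
    lift w to 𝔻 using hw
    have hc : ContinuousAt (fun y => ‖mob w y‖) w :=
      (hasDerivAt_mob w.norm_lt_one w.norm_lt_one).continuousAt.norm
    have hn : ∀ᶠ y in 𝓝 (w : ℂ), ‖mob w y‖ < ε / 100 :=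
      hc.eventually_lt_const (by simpa [mob_self] using hε)
    refine ⟨{y | ‖mob w y‖ < ε / 100} ∩ Metric.ball 0 1,
      mem_nhdsWithin_of_mem_nhds (inter_mem hn (ball_mem_nhds w)), ?_⟩
    filter_upwards [hball, Metric.tendsto_nhds.1 (hF w) (ε / 2) (by positivity)] with g hg hgw
    rintro y ⟨hy, hy1⟩
    rw [mem_ball_zero_iff] at hy1
    lift y to 𝔻 using hy1
    rw [ext_coe, ext_coe, dist_eq_norm]
    rw [dist_eq_norm] at hgw
    have h1 := hF2 y w
    have h2 := HInf.norm_apply_sub_le g hg w y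
    have hρ : pseudoDist y w < ε / 100 := hy
    rw [pseudoDist_comm] at h2
    have h3 := norm_sub_le (F y - F w) ((g : 𝔻 →ᵇ ℂ) w - F w)
    have h4 := norm_add_le (F y - F w - ((g : 𝔻 →ᵇ ℂ) w - F w))
      ((g : 𝔻 →ᵇ ℂ) w - (g : 𝔻 →ᵇ ℂ) y)
    rw [show F y - F w - ((g : 𝔻 →ᵇ ℂ) w - F w) + ((g : 𝔻 →ᵇ ℂ) w - (g : 𝔻 →ᵇ ℂ) y) =
      F y - (g : 𝔻 →ᵇ ℂ) y by ring] at h4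
    linarith
  have hFh : Holo F := hloc.differentiableOn (Eventually.of_forall fun g => g.2)
    Metric.isOpen_ball
  have hFb : ∀ z, ‖F z‖ ≤ 1 := fun z => by simpa using hF1 z
  refine ⟨mkHInf F hFh 1 hFb, norm_mkHInf_le F hFh hFb, hF, fun r hr δ hδ => ?_⟩
  have hK : IsCompact {y : ℂ | r ≤ 1 - ‖y‖ ^ 2} := by
    refine Metric.isCompact_of_isClosed_isBounded
      (isClosed_le continuous_const (by fun_prop)) ?_
    refine Metric.isBounded_closedBall.subset (fun y hy => ?_ : _ ⊆ Metric.closedBall (0 : ℂ) 1)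
    rw [Set.mem_ofPred_eq] at hy
    rw [mem_closedBall_zero_iff]
    nlinarith [norm_nonneg y]
  have hKs : {y : ℂ | r ≤ 1 - ‖y‖ ^ 2} ⊆ Metric.ball 0 1 := fun y hy => by
    rw [Set.mem_ofPred_eq] at hy
    rw [mem_ball_zero_iff]
    nlinarith [norm_nonneg y]
  have hu := (tendstoLocallyUniformlyOn_iff_forall_isCompact Metric.isOpen_ball).1 hloc _ hKs hK
  filter_upwards [Metric.tendstoUniformlyOn_iff.1 hu δ hδ] with g hg w hw
  have := hg w hw
  rw [ext_coe, ext_coe, dist_comm, dist_eq_norm] at this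
  exact this.le

/-- An ultrafilter on the image of the unit ball lifts to the ball, where Montel's theorem gives a
limit `f`. The differences `g - f` are bounded by `2` and small on compact sets, which controls the
seminorm of `T (g - f)`; pointwise convergence controls its value at `0`. -/
theorem isCompactOperator_of_compact_small {u v : 𝔻 → ℂ} {φ ψ : 𝔻 → 𝔻} {T : HInf →L[ℂ] Bloch}
    (hT : Restricts (wComp u φ - wComp v ψ) T)
    (h : ∀ ε > 0, ∃ r > 0, ∃ δ > 0, ∀ f, Holo f → (∀ z, ‖f z‖ ≤ 2) →
      (∀ w, r ≤ defect w → ‖f w‖ ≤ δ) →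
      ∀ z, ‖invDeriv ((wComp u φ - wComp v ψ) f) z‖ ≤ ε) : IsCompactOperator T := by
  refine (isCompactOperator_iff_image_closedBall_subset_compact (T : HInf →ₗ[ℂ] Bloch)
    one_pos).2 ⟨_, ?_, subset_rfl⟩
  rw [isCompact_iff_ultrafilter_le_nhds]
  intro W hW
  have hW' : T '' Metric.closedBall 0 1 ∈ W := le_principal_iff.1 hW
  set V := Ultrafilter.ofComapInfPrincipal hW'
  have hVW : V.map T = W := Ultrafilter.ofComapInfPrincipal_eq_of_map hW'
  have hV : Metric.closedBall 0 1 ∈ V := Ultrafilter.ofComapInfPrincipal_mem hW'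
  obtain ⟨f, hf1, hpt, hf⟩ := HInf.exists_limit V hV
  refine ⟨T f, ⟨f, HInf.mem_closedBall.2 hf1, rfl⟩, ?_⟩
  rw [← hVW]
  change Tendsto T V (𝓝 (T f))
  rw [Metric.tendsto_nhds]
  intro ε hε
  obtain ⟨r, hr, δ, hδ, H⟩ := h (ε / 4) (by positivity)
  have h0 : Tendsto (fun g : HInf => (T g).toFun 0) V (𝓝 ((T f).toFun 0)) := by
    rw [hT]
    simp only [hT _]
    exact ((hpt _).const_mul _).sub ((hpt _).const_mul _)
  filter_upwards [hf r hr δ hδ, hV, Metric.tendsto_nhds.1 h0 (ε / 4) (by positivity)]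
    with g hg hg1 hg0
  have hg1' : ‖g‖ ≤ 1 := HInf.mem_closedBall.1 hg1
  rw [dist_eq_norm, ← map_sub]
  have e0 : (T (g - f)).toFun 0 = (T g).toFun 0 - (T f).toFun 0 := by
    rw [map_sub]
    rfl
  have := Bloch.norm_le (g := T (g - f)) (ε := ε / 4) (η := ε / 4)
    (by rw [e0, ← dist_eq_norm]; exact hg0.le) (by positivity) fun z => by
      rw [hT]
      refine H _ (g - f).2 (fun z => ?_) hg z
      refine (HInf.norm_apply_le (g - f) z).trans ((norm_sub_le g f).trans ?_)
      linarith
  linarith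

/-- On the disc of radius `|z|` the derivative is at most `‖g‖ / (1 - |z|²)`. This makes point
evaluations continuous on the Bloch space, so norm limits are identified pointwise. -/
theorem Bloch.norm_apply_le (g : Bloch) (z : 𝔻) : ‖g.toFun z‖ ≤ (1 + 1 / defect z) * ‖g‖ := by
  have hz := defect_pos z
  have hsub : ∀ x ∈ Metric.closedBall (0 : ℂ) ‖(z : ℂ)‖, ‖x‖ < 1 := fun x hx =>
    (mem_closedBall_zero_iff.1 hx).trans_lt z.norm_lt_one
  have h1 := (convex_closedBall (0 : ℂ) ‖(z : ℂ)‖).norm_image_sub_le_of_norm_deriv_le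
    (f := ext g.toFun) (C := ‖g‖ / defect z) (x := 0) (y := z)
    (fun x hx => by
      have := hsub x hx
      lift x to 𝔻 using this
      exact g.holo.differentiableAt x)
    (fun x hx => by
      have h := hsub x hx
      rw [mem_closedBall_zero_iff] at hx
      lift x to 𝔻 using h
      have h2 := g.norm_invDeriv_le x
      rw [invDeriv, norm_mul, Complex.norm_of_nonneg (defect_pos x).le] at h2
      rw [le_div_iff₀ hz, mul_comm]
      refine le_trans ?_ h2
      refine mul_le_mul_of_nonneg_right ?_ (norm_nonneg _)
      unfold defect
      gcongr) (by simp) (by simp)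
  have h3 : ext g.toFun 0 = g.toFun 0 := ext_coe g.toFun 0
  rw [ext_coe, h3, sub_zero] at h1
  have h4 : ‖g.toFun 0‖ ≤ ‖g‖ := by
    rw [Bloch.norm_def]
    exact le_add_of_nonneg_right ENNReal.toReal_nonneg
  have h5 : ‖g‖ / defect z * ‖(z : ℂ)‖ ≤ ‖g‖ / defect z :=
    mul_le_of_le_one_right (by positivity) z.norm_lt_one.le
  have h6 := norm_sub_norm_le (g.toFun z) (g.toFun 0)
  rw [add_mul, one_mul, one_div, inv_mul_eq_div]
  linarith

theorem Bloch.tendsto_apply {ι : Type*} {l : Filter ι} {G : ι → Bloch} {g : Bloch}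
    (h : Tendsto G l (𝓝 g)) (z : 𝔻) : Tendsto (fun i => (G i).toFun z) l (𝓝 (g.toFun z)) := by
  rw [tendsto_iff_norm_sub_tendsto_zero] at h ⊢
  refine squeeze_zero (fun _ => norm_nonneg _) (fun i => (G i - g).norm_apply_le z) ?_
  simpa using h.const_mul (1 + 1 / defect z)

/-- A compact operator maps bounded families with pointwise null images to null families. -/
theorem tendsto_zero_of_isCompactOperator {T : HInf →L[ℂ] Bloch} (hT : IsCompactOperator T)
    {ι : Type*} {l : Filter ι} {F : ι → HInf} (hF : ∀ i, ‖F i‖ ≤ 1)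
    (h : ∀ z, Tendsto (fun i => (T (F i)).toFun z) l (𝓝 0)) :
    Tendsto (fun i => T (F i)) l (𝓝 0) := by
  obtain ⟨K, hK, hKT⟩ := IsCompactOperator.image_closedBall_subset_compact
    (f := (T : HInf →ₗ[ℂ] Bloch)) hT 1
  rw [tendsto_iff_ultrafilter]
  intro W hW
  obtain ⟨x, -, hx⟩ := isCompact_iff_ultrafilter_le_nhds.1 hK (W.map fun i => T (F i)) <|
    le_principal_iff.2 <| Filter.mem_map.2 <| Eventually.of_forall fun i =>
      hKT ⟨F i, HInf.mem_closedBall.2 (hF i), rfl⟩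
  have hx' : Tendsto (fun i => T (F i)) W (𝓝 x) := hx
  have : x = 0 := by
    apply Subtype.ext
    funext z
    exact tendsto_nhds_unique (Bloch.tendsto_apply hx' z) ((h z).mono_left hW)
  rwa [this] at hx'

/-! ### Absolutely convergent power series -/

/-- `f` is the sum of a power series whose coefficients are bounded by `η` and have absolute sum at
most `M`. -/
def HasAbsSeries (M η : ℝ) (f : 𝔻 → ℂ) : Prop :=
  ∃ c : ℕ → ℂ, (Summable fun k => ‖c k‖) ∧ ∑' k, ‖c k‖ ≤ M ∧ (∀ k, ‖c k‖ ≤ η) ∧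
    ∀ z : 𝔻, HasSum (fun k => c k * (z : ℂ) ^ k) (f z)

theorem summable_norm_mul_pow {c : ℕ → ℂ} (hc : Summable fun k => ‖c k‖) (z : 𝔻) :
    Summable fun k => ‖c k * (z : ℂ) ^ k‖ := by
  refine hc.of_nonneg_of_le (fun _ => norm_nonneg _) fun k => ?_
  rw [norm_mul, norm_pow]
  exact mul_le_of_le_one_right (norm_nonneg _) (pow_le_one₀ (norm_nonneg _) z.norm_lt_one.le)

/-- The coefficients of a Cauchy product are a convolution, bounded by `ℓ¹ * ℓ¹` in sum and by `ℓ¹ *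
ℓ^∞` termwise. The factor with small coefficients has to stand on the right. -/
theorem HasAbsSeries.mul {M M' η η' : ℝ} {f g : 𝔻 → ℂ} (hf : HasAbsSeries M η f)
    (hg : HasAbsSeries M' η' g) : HasAbsSeries (M * M') (M * η') (f * g) := by
  obtain ⟨c, hc, hcM, -, hcf⟩ := hf
  obtain ⟨d, hd, hdM, hdη, hdg⟩ := hg
  have hcs : (0 : ℝ) ≤ ∑' k, ‖c k‖ := tsum_nonneg fun _ => norm_nonneg _
  have hds : (0 : ℝ) ≤ ∑' k, ‖d k‖ := tsum_nonneg fun _ => norm_nonneg _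
  have hη' : 0 ≤ η' := (norm_nonneg _).trans (hdη 0)
  have hs := summable_norm_sum_mul_antidiagonal_of_summable_norm hc.norm hd.norm
  have hle : ∀ n, ‖∑ kl ∈ Finset.HasAntidiagonal.antidiagonal n, c kl.1 * d kl.2‖ ≤
      ∑ kl ∈ Finset.HasAntidiagonal.antidiagonal n, ‖c kl.1‖ * ‖d kl.2‖ := fun n =>
    (norm_sum_le _ _).trans (Finset.sum_le_sum fun kl _ => (norm_mul _ _).le)
  have hs' : Summable fun n => ∑ kl ∈ Finset.HasAntidiagonal.antidiagonal n, ‖c kl.1‖ * ‖d kl.2‖ := hs.of_norm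
  refine ⟨fun n => ∑ kl ∈ Finset.HasAntidiagonal.antidiagonal n, c kl.1 * d kl.2,
    summable_norm_sum_mul_antidiagonal_of_summable_norm hc hd, ?_, fun n => ?_, fun z => ?_⟩
  · refine (Summable.tsum_le_tsum hle
      (summable_norm_sum_mul_antidiagonal_of_summable_norm hc hd) hs').trans ?_
    rw [← tsum_mul_tsum_eq_tsum_sum_antidiagonal_of_summable_norm hc.norm hd.norm]
    gcongr
    exact hcs.trans hcM
  · refine (hle n).trans ?_
    calc ∑ kl ∈ Finset.HasAntidiagonal.antidiagonal n, ‖c kl.1‖ * ‖d kl.2‖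
        ≤ ∑ kl ∈ Finset.HasAntidiagonal.antidiagonal n, ‖c kl.1‖ * η' :=
          Finset.sum_le_sum fun kl _ => mul_le_mul_of_nonneg_left (hdη _) (norm_nonneg _)
      _ = (∑ k ∈ Finset.range (n + 1), ‖c k‖) * η' := by
          rw [← Finset.sum_mul, Finset.Nat.sum_antidiagonal_eq_sum_range_succ fun i _ => ‖c i‖]
      _ ≤ M * η' := by
          gcongr
          exact (hc.sum_le_tsum _ fun _ _ => norm_nonneg _).trans hcM
  · have h1 := summable_norm_mul_pow hc z
    have h2 := summable_norm_mul_pow hd z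
    have h3 := tsum_mul_tsum_eq_tsum_sum_antidiagonal_of_summable_norm h1 h2
    have h4 := (summable_norm_sum_mul_antidiagonal_of_summable_norm h1 h2).of_norm.hasSum
    rw [← h3, (hcf z).tsum_eq, (hdg z).tsum_eq] at h4
    refine h4.congr_fun fun n => ?_
    rw [Finset.sum_mul]
    refine Finset.sum_congr rfl fun kl hkl => ?_
    rw [← Finset.HasAntidiagonal.mem_antidiagonal.1 hkl, pow_add]
    ring

/-- `σ_a(z) - a = -(1 - |a|²) ∑ ā^k z^(k+1)`, whose coefficients have absolute sum `1 + |a| ≤ 2`.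
The free constant `c₀` serves both `σ_a` and `σ_a - a`. -/
theorem hasAbsSeries_σ_add (a : 𝔻) (c₀ : ℂ) {η : ℝ} (h0 : ‖c₀‖ ≤ η) (hη : defect a ≤ η) :
    HasAbsSeries (‖c₀‖ + 2) η (fun z => c₀ + (σ a z - a)) := by
  have ha := a.norm_lt_one
  have hda := defect_pos a
  set c : ℕ → ℂ := fun k => Nat.casesOn k c₀ fun k => -(defect a : ℂ) * conj (a : ℂ) ^ k
  have hn : ∀ k, ‖c (k + 1)‖ = defect a * ‖(a : ℂ)‖ ^ k := fun k => by
    change ‖-(defect a : ℂ) * conj (a : ℂ) ^ k‖ = _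
    rw [norm_mul, norm_neg, norm_pow, Complex.norm_conj, Complex.norm_of_nonneg hda.le]
  have hs : HasSum (fun k => ‖c k‖) (‖c₀‖ + defect a * (1 - ‖(a : ℂ)‖)⁻¹) := by
    rw [← hasSum_nat_add_iff' 1]
    simp only [hn, Finset.range_one, Finset.sum_singleton]
    rw [show ‖c 0‖ = ‖c₀‖ from rfl, add_sub_cancel_left]
    exact (hasSum_geometric_of_lt_one (norm_nonneg _) ha).mul_left _
  refine ⟨c, hs.summable, ?_, fun k => ?_, fun z => ?_⟩
  · rw [hs.tsum_eq]
    gcongr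
    rw [← div_eq_mul_inv, div_le_iff₀ (by linarith), defect]
    nlinarith [norm_nonneg (a : ℂ)]
  · cases k with
    | zero => exact h0
    | succ k =>
      rw [hn]
      exact (mul_le_of_le_one_right hda.le (pow_le_one₀ (norm_nonneg _) ha.le)).trans hη
  · have hne := one_sub_conj_mul_ne_zero ha z.norm_lt_one
    have hlt : ‖conj (a : ℂ) * z‖ < 1 := by
      rw [norm_mul, Complex.norm_conj]
      nlinarith [norm_nonneg (a : ℂ), norm_nonneg (z : ℂ), z.norm_lt_one]
    rw [← hasSum_nat_add_iff' 1]
    simp only [Finset.range_one, Finset.sum_singleton, pow_zero, mul_one]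
    rw [show c 0 = c₀ from rfl, add_sub_cancel_left]
    have hg := (hasSum_geometric_of_norm_lt_one hlt).mul_left (-(defect a : ℂ) * z)
    have e : σ a z - a = -(defect a : ℂ) * z * (1 - conj (a : ℂ) * z)⁻¹ := by
      have hd : (defect a : ℂ) = 1 - conj (a : ℂ) * a := by
        rw [Complex.conj_mul', defect]
        push_cast
        ring
      rw [σ, hd, div_sub' hne, div_eq_mul_inv]
      ring
    rw [e]
    refine hg.congr_fun fun k => ?_
    change -(defect a : ℂ) * conj (a : ℂ) ^ k * (z : ℂ) ^ (k + 1) = _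
    rw [mul_pow, pow_succ]
    ring

theorem hasAbsSeries_σ (a : 𝔻) : HasAbsSeries 3 1 (σ a) := by
  obtain ⟨c, h1, h2, h3, h4⟩ := hasAbsSeries_σ_add a a a.norm_lt_one.le (defect_le_one a)
  exact ⟨c, h1, h2.trans (by linarith [a.norm_lt_one]), h3, fun z => by simpa using h4 z⟩

theorem hasAbsSeries_σ_sub (a : 𝔻) :
    HasAbsSeries 2 (defect a) (σ a - (a : ℂ) • 1) := by
  obtain ⟨c, h1, h2, h3, h4⟩ := hasAbsSeries_σ_add a 0 (by simpa using (defect_pos a).le) le_rfl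
  exact ⟨c, h1, by simpa using h2, h3, fun z => by simpa using h4 z⟩

/-- The test function is `σ_a^n σ_b^m (σ_a - a)`: at most three factors with sum `3`, then one with
sum `2` and coefficients at most `defect a`. -/
theorem hasAbsSeries_testFun (n m : ℕ) (hn : n ≤ 1) (hm : m ≤ 2) (a b : 𝔻) :
    HasAbsSeries 54 (27 * defect a) (testFun n m a b) := by
  have weaken : ∀ {M M' η η' : ℝ} {f : 𝔻 → ℂ}, HasAbsSeries M η f → M ≤ M' → η ≤ η' →
      HasAbsSeries M' η' f := by
    rintro M M' η η' f ⟨c, h1, h2, h3, h4⟩ hM hη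
    exact ⟨c, h1, h2.trans hM, fun k => (h3 k).trans hη, h4⟩
  have hd := (defect_pos a).le
  have h0 := hasAbsSeries_σ_sub a
  have ha := hasAbsSeries_σ a
  have hb := hasAbsSeries_σ b
  interval_cases n <;> interval_cases m
  · rw [show testFun 0 0 a b = σ a - (a : ℂ) • 1 by simp [testFun]]
    exact weaken h0 (by norm_num) (by linarith)
  · rw [show testFun 0 1 a b = σ b * (σ a - (a : ℂ) • 1) by simp [testFun, mul_comm]]
    exact weaken (hb.mul h0) (by norm_num) (by linarith)
  · rw [show testFun 0 2 a b = σ b * σ b * (σ a - (a : ℂ) • 1) by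
      simp [testFun, mul_comm, sq]]
    exact weaken ((hb.mul hb).mul h0) (by norm_num) (by linarith)
  · rw [show testFun 1 0 a b = σ a * (σ a - (a : ℂ) • 1) by
      funext z
      simp [testFun]
      ring]
    exact weaken (ha.mul h0) (by norm_num) (by linarith)
  · rw [show testFun 1 1 a b = σ a * σ b * (σ a - (a : ℂ) • 1) by
      funext z
      simp [testFun]
      ring]
    exact weaken ((ha.mul hb).mul h0) (by norm_num) (by linarith)
  · rw [show testFun 1 2 a b = σ a * σ b * σ b * (σ a - (a : ℂ) • 1) by
      funext z
      simp [testFun]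
      ring]
    exact weaken (((ha.mul hb).mul hb).mul h0) (by norm_num) (by linarith)

theorem norm_coe_pow_le_one (k : ℕ) (z : 𝔻) : ‖((fun z : 𝔻 => (z : ℂ)) ^ k) z‖ ≤ 1 := by
  rw [Pi.pow_apply, norm_pow]
  exact pow_le_one₀ (norm_nonneg _) z.norm_lt_one.le

/-- The monomial `z ^ k` as an element of `H^∞`. -/
def monomial (k : ℕ) : HInf :=
  mkHInf ((fun z : 𝔻 => (z : ℂ)) ^ k) (Holo.coe.pow k) 1 (norm_coe_pow_le_one k)

theorem norm_monomial_le (k : ℕ) : ‖monomial k‖ ≤ 1 := norm_mkHInf_le _ _ _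

/-- The series converges absolutely in `H^∞` because `‖z^k‖ ≤ 1`, so a bounded operator may be
applied term by term. -/
theorem hasSum_monomial {c : ℕ → ℂ} (hc : Summable fun k => ‖c k‖) {f : HInf}
    (hf : ∀ z : 𝔻, HasSum (fun k => c k * (z : ℂ) ^ k) ((f : 𝔻 →ᵇ ℂ) z)) :
    HasSum (fun k => c k • monomial k) f := by
  have hs : Summable fun k => c k • (monomial k : 𝔻 →ᵇ ℂ) := by
    refine Summable.of_norm_bounded hc fun k => ?_
    rw [norm_smul]
    exact mul_le_of_le_one_right (norm_nonneg _) (norm_monomial_le k)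
  have hfs : (f : 𝔻 →ᵇ ℂ) = ∑' k, c k • (monomial k : 𝔻 →ᵇ ℂ) := by
    ext z
    have h1 := hs.hasSum.mapL (BoundedContinuousFunction.evalCLM ℂ z)
    exact (hf z).unique h1
  have h2 : HasSum (fun k => c k • (monomial k : 𝔻 →ᵇ ℂ)) (f : 𝔻 →ᵇ ℂ) := by
    rw [hfs]
    exact hs.hasSum
  exact (Topology.IsInducing.hasSum_iff (g := HInf.subtype) Topology.IsInducing.subtypeVal
    (fun k => c k • monomial k) f).1 h2

theorem norm_map_le_of_hasAbsSeries {T : HInf →L[ℂ] Bloch} {ε : ℝ} {N : ℕ}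
    (hN : ∀ k ≥ N, ‖T (monomial k)‖ ≤ ε) {M η : ℝ} {f : HInf}
    (hf : HasAbsSeries M η (f : 𝔻 →ᵇ ℂ)) : ‖T f‖ ≤ N * (η * ‖T‖) + M * ε := by
  obtain ⟨c, h1, h2, h3, h4⟩ := hf
  have hε : 0 ≤ ε := (norm_nonneg _).trans (hN N le_rfl)
  have hη : 0 ≤ η := (norm_nonneg _).trans (h3 0)
  have hT := (hasSum_monomial h1 h4).mapL T
  have g1 : HasSum (fun k => if k ∈ Finset.range N then η * ‖T‖ else 0) (N * (η * ‖T‖)) := by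
    have : HasSum (fun k => if k ∈ Finset.range N then η * ‖T‖ else 0)
        (∑ k ∈ Finset.range N, if k ∈ Finset.range N then η * ‖T‖ else 0) :=
      hasSum_sum_of_ne_finset_zero fun k hk => if_neg hk
    rwa [Finset.sum_congr rfl fun k hk => if_pos hk, Finset.sum_const, Finset.card_range,
      nsmul_eq_mul] at this
  refine (hT.norm_le_of_bounded (g1.add (h1.hasSum.mul_right ε)) fun k => ?_).trans (by gcongr)
  rw [map_smul, norm_smul]
  by_cases hk : k < N
  · rw [if_pos (Finset.mem_range.2 hk)]
    have := T.le_opNorm_of_le (norm_monomial_le k)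
    rw [mul_one] at this
    have h5 : ‖c k‖ * ‖T (monomial k)‖ ≤ η * ‖T‖ := by
      gcongr
      exact h3 k
    linarith [mul_nonneg (norm_nonneg (c k)) hε]
  · rw [if_neg (by simpa using hk), zero_add]
    gcongr
    exact hN k (not_lt.1 hk)

theorem tendsto_zero_of_le_ofReal {ι : Type*} {l : Filter ι} {F : ι → ℝ≥0∞}
    (h : ∀ ε : ℝ, 0 < ε → ∀ᶠ x in l, F x ≤ ENNReal.ofReal ε) : Tendsto F l (𝓝 0) := by
  rw [ENNReal.tendsto_nhds_zero]
  intro η hη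
  obtain ⟨r, hr, hrη⟩ := ENNReal.lt_iff_exists_nnreal_btwn.1 hη
  have hr' : 0 < (r : ℝ) := by simpa using hr
  filter_upwards [h r hr'] with x hx
  rw [ENNReal.ofReal_coe_nnreal] at hx
  exact hx.trans hrη.le

/-! ### The main theorem -/

section

variable {u v : 𝔻 → ℂ} {φ ψ : 𝔻 → 𝔻} {T : HInf →L[ℂ] Bloch}

theorem toFun_map_monomial (hT : Restricts (wComp u φ - wComp v ψ) T) (k : ℕ) :
    (T (monomial k)).toFun = fun z => u z * (φ z : ℂ) ^ k - v z * (ψ z : ℂ) ^ k := by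
  rw [hT]
  rfl

theorem tendsto_map_monomial_apply (hT : Restricts (wComp u φ - wComp v ψ) T) (z : 𝔻) :
    Tendsto (fun k => (T (monomial k)).toFun z) atTop (𝓝 0) := by
  simp only [toFun_map_monomial hT]
  have h1 := (tendsto_pow_atTop_nhds_zero_of_norm_lt_one (φ z).norm_lt_one).const_mul (u z)
  have h2 := (tendsto_pow_atTop_nhds_zero_of_norm_lt_one (ψ z).norm_lt_one).const_mul (v z)
  simpa using h1.sub h2

theorem tendsto_blochSemi_of_isCompactOperator (hT : Restricts (wComp u φ - wComp v ψ) T)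
    (hc : IsCompactOperator T) :
    Tendsto (fun k : ℕ => blochSemi (fun z => u z * (φ z : ℂ) ^ k - v z * (ψ z : ℂ) ^ k))
      atTop (𝓝 0) := by
  have h := (tendsto_zero_of_isCompactOperator hc norm_monomial_le
    (tendsto_map_monomial_apply hT)).norm
  rw [norm_zero] at h
  refine tendsto_zero_of_le_ofReal fun ε hε => ?_
  filter_upwards [h.eventually_le_const hε] with k hk
  rw [← toFun_map_monomial hT]
  exact (Bloch.blochSemi_le _).trans (ENNReal.ofReal_le_ofReal hk)

theorem testVanish_of_tendsto_blochSemi (hT : Restricts (wComp u φ - wComp v ψ) T)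
    (h : Tendsto (fun k : ℕ => blochSemi (fun z => u z * (φ z : ℂ) ^ k - v z * (ψ z : ℂ) ^ k))
      atTop (𝓝 0)) {n m : ℕ} (hn : n ≤ 1) (hm : m ≤ 2) : TestVanish u v φ ψ n m := by
  -- The hypothesis concerns only the seminorm; the values at `0` tend to zero because `|φ(0)|` and
  -- `|ψ(0)|` are less than `1`.
  have hnorm : Tendsto (fun k => ‖T (monomial k)‖) atTop (𝓝 0) := by
    have h1 := (tendsto_map_monomial_apply hT 0).norm
    have h2 := (ENNReal.tendsto_toReal ENNReal.zero_ne_top).comp h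
    simpa [Bloch.norm_def, toFun_map_monomial hT, Function.comp_def] using h1.add h2
  refine tendsto_zero_of_le_ofReal fun ε hε => ?_
  -- The tail contributes `54 · ε/108 = ε/2`; with `N` now fixed, the first `N` terms vanish as
  -- `defect a → 0`.
  obtain ⟨N, hN⟩ := eventually_atTop.1
    (hnorm.eventually_le_const (show 0 < ε / 108 by positivity))
  have hd : Tendsto (fun a => N * (27 * defect a * ‖T‖)) toBoundary (𝓝 0) := by
    simpa using ((tendsto_defect_toBoundary.const_mul 27).mul_const ‖T‖).const_mul (N : ℝ)
  filter_upwards [hd.eventually_le_const (show 0 < ε / 2 by positivity)] with a ha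
  refine iSup_le fun b => ?_
  have hs := hasAbsSeries_testFun n m hn hm a b
  have hbd : ∀ z, ‖testFun n m a b z‖ ≤ 54 := fun z => by
    obtain ⟨c, h1, h2, -, h4⟩ := hs
    refine ((h4 z).norm_le_of_bounded h1.hasSum fun k => ?_).trans h2
    rw [norm_mul, norm_pow]
    exact mul_le_of_le_one_right (norm_nonneg _) (pow_le_one₀ (norm_nonneg _) z.norm_lt_one.le)
  have h5 := norm_map_le_of_hasAbsSeries hN (f := mkHInf _ (Holo.testFun n m a b) 54 hbd) hs
  have h6 := (T (mkHInf _ (Holo.testFun n m a b) 54 hbd)).blochSemi_le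
  rw [hT] at h6
  exact h6.trans (ENNReal.ofReal_le_ofReal (by linarith))

theorem isCompactOperator_of_testVanish (hu : Holo u) (hv : Holo v)
    (hφ : Holo (fun z => (φ z : ℂ))) (hψ : Holo (fun z => (ψ z : ℂ))) (hA : CondA u v φ ψ)
    (hB : CondB u v φ ψ) (hT : Restricts (wComp u φ - wComp v ψ) T)
    (h00 : TestVanish u v φ ψ 0 0) (h01 : TestVanish u v φ ψ 0 1)
    (h02 : TestVanish u v φ ψ 0 2) (h12 : TestVanish u v φ ψ 1 2) : IsCompactOperator T := by
  refine isCompactOperator_of_compact_small hT fun ε hε => ?_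
  have hK : ∀ f, Holo f → (∀ z, ‖f z‖ ≤ 1) → ∀ z, ‖pointJet u v φ ψ z f‖ ≤ ‖T‖ := by
    intro f hf hf1 z
    have h1 := (T (mkHInf f hf 1 hf1)).norm_invDeriv_le z
    rw [hT, coe_mkHInf, invDeriv_wComp_sub hu hv hφ hψ hf] at h1
    simpa using h1.trans (T.le_opNorm_of_le (norm_mkHInf_le f hf hf1))
  obtain ⟨r, hr, δ, hδ, H⟩ := exists_compact_small hu hv hφ hψ hA hB hK h00 h01 h02 h12 hε
  refine ⟨r, hr, δ, hδ, fun f hf hf2 hs z => ?_⟩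
  rw [invDeriv_wComp_sub hu hv hφ hψ hf]
  exact H f hf hf2 hs z

end

end BlochDiff

end

theorem theorem3p2 (u v : 𝔻 → ℂ) (φ ψ : 𝔻 → 𝔻)
    (hu : Holo u) (hv : Holo v)
    (hφ : Holo (fun z => (φ z : ℂ))) (hψ : Holo (fun z => (ψ z : ℂ)))
    (hA : CondA u v φ ψ) (hB : CondB u v φ ψ)
    (hbdd : IsBoundedOp (wComp u φ - wComp v ψ)) :
    List.TFAE [
      IsCompactOp (wComp u φ - wComp v ψ),
      ∀ p ∈ ({(0, 0), (0, 1), (0, 2), (1, 2)} : Set (ℕ × ℕ)),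
        Tendsto
          (fun a : 𝔻 => ⨆ b : 𝔻, blochSemi ((wComp u φ - wComp v ψ) (testFun p.1 p.2 a b)))
          toBoundary (𝓝 0),
      Tendsto
        (fun k : ℕ => blochSemi (fun z => u z * (φ z : ℂ) ^ k - v z * (ψ z : ℂ) ^ k))
        atTop (𝓝 0)] := by
  obtain ⟨T, hT⟩ := hbdd
  tfae_have 1 → 3 := by
    rintro ⟨T, hT, hc⟩
    exact tendsto_blochSemi_of_isCompactOperator hT hc
  tfae_have 3 → 2 := by
    rintro h ⟨n, m⟩ hp
    have hnm : n ≤ 1 ∧ m ≤ 2 := by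
      simp only [Set.mem_insert_iff, Set.mem_singleton_iff, Prod.mk.injEq] at hp
      omega
    exact testVanish_of_tendsto_blochSemi hT h hnm.1 hnm.2
  tfae_have 2 → 1 := fun h =>
    ⟨T, hT, isCompactOperator_of_testVanish hu hv hφ hψ hA hB hT (h (0, 0) (by simp))
      (h (0, 1) (by simp)) (h (0, 2) (by simp)) (h (1, 2) (by simp))⟩
  tfae_finish
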